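/- Let $\Bbbk$ be a field of characteristic $0$, let $S=\Bbbk[x_1,\dots,x_n]$ with the standard grading, and let $d_1,\dots,d_s$ be integers such that one of the following holds: - $n=3$, $s=2$, and $2\le d_1,d_2\le 3$; - $n=3$, $s=3$, and $2\le d_1,d_2,d_3\le 3$; - $n=4$, $s=3$, and $2\le d_1,d_2,d_3\le 3$. Let $N=\sum_{i=1}^s\binom{n+d_i-1}{d_i}$. For a point $\mathbf a\in\mathbb A^N_\Bbbk=\Bbbk^N$ let $I_{\mathbf a}=(f_1,\dots,f_s)\subseteq S$, where $f_i$ is the form of degree $d_i$ whose coefficients at the monomials of degree $d_i$ are the corresponding coordinates of $\mathbf a$. Let $U$ be the set of those $\mathbf a$ with $\dim_\Bbbk(S/I_{\mathbf a})_e\le\dim_\Bbbk(S/I_{\mathbf b})_e$ for all $e\ge 0$ and all $\mathbf b\in\mathbb A^N_\Bbbk$. Let $\mathrm{in}(I)$ denote the initial ideal of $I$ with respect to the lexicographic order with $x_1\succ\cdots\succ x_n$, and let $V\subseteq U$ be the union of all Zariski open dense subsets of $\mathbb A^N_\Bbbk$ that are contained in $U$ and on which $\mathrm{in}(I_{\mathbf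 a})$ is constant. Then $V$ is itself a Zariski open dense subset of $\mathbb A^N_\Bbbk$ on which $\mathrm{in}(I_{\mathbf a})$ is constant, and for every $\mathbf a\in V$ (that is, for every $V$-generic ideal $I_{\mathbf a}$) the initial ideal $\mathrm{in}(I_{\mathbf a})$ is a lexsegment ideal: it is a monomial ideal such that for every monomial $m\in\mathrm{in}(I_{\mathbf a})$, each monomial $m'$ with $\deg m'=\deg m$ and $m'\succeq m$ also belongs to $\mathrm{in}(I_{\mathbf a})$. -/

import Mathlib

open MvPolynomial
open scoped MonomialOrder

noncomputable section

namespace GenericIdeal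

section Zariski

variable {k : Type*} [Field k] {σ : Type*}

/-- Zariski open subsets of the affine space `σ → k`: complements of zero loci. -/
def IsZariskiOpen (W : Set (σ → k)) : Prop :=
  ∃ T : Ideal (MvPolynomial σ k), W = (zeroLocus k T)ᶜ

/-- Zariski dense subsets of `σ → k`: the only Zariski closed set containing them is the whole
space. -/
def IsZariskiDense (W : Set (σ → k)) : Prop :=
  ∀ T : Ideal (MvPolynomial σ k), W ⊆ zeroLocus k T → zeroLocus k T = Set.univ

end Zariski

section Polynomials

variable {k : Type*} [Field k] {n : ℕ}

/-- The exponents of the monomials of degree `e` in `n` variables. -/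
abbrev Mon (n e : ℕ) : Type :=
  {m : Fin n →₀ ℕ // m ∈ (Finset.univ : Finset (Fin n)).finsuppAntidiag e}

/-- The points of the parameter space `𝔸^N`: for each `i`, one coefficient for each monomial of
degree `d i`. -/
abbrev Params (k : Type*) (n : ℕ) {s : ℕ} (d : Fin s → ℕ) : Type _ :=
  ((i : Fin s) × Mon n (d i)) → k

/-- The form `f_i` of degree `d i` whose coefficients are given by the point `a`. -/
def form {s : ℕ} {d : Fin s → ℕ} (a : Params k n d) (i : Fin s) : MvPolynomial (Fin n) k :=
  ∑ m : Mon n (d i), monomial m.1 (a ⟨i, m⟩)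

/-- The ideal `(f_1, …, f_s)` corresponding to the point `a`. -/
def idealOf {s : ℕ} {d : Fin s → ℕ} (a : Params k n d) : Ideal (MvPolynomial (Fin n) k) :=
  Ideal.span (Set.range (form a))

/-- The Hilbert function `e ↦ dim_k (S/I)_e`, where `(S/I)_e` is the image of `S_e` in `S/I`. -/
def hilbertFunction (I : Ideal (MvPolynomial (Fin n) k)) (e : ℕ) : ℕ :=
  Module.finrank k
    ((homogeneousSubmodule (Fin n) k e).map (Ideal.Quotient.mkₐ k I).toLinearMap)

/-- The initial ideal of `I`, spanned by the initial terms of the elements of `I`. -/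
def initialIdeal (ord : MonomialOrder (Fin n)) (I : Ideal (MvPolynomial (Fin n) k)) :
    Ideal (MvPolynomial (Fin n) k) :=
  Ideal.span (ord.leadingTerm '' (I : Set (MvPolynomial (Fin n) k)))

/-- `J` is generated by monomials. -/
def IsMonomialIdeal (J : Ideal (MvPolynomial (Fin n) k)) : Prop :=
  ∃ M : Set (Fin n →₀ ℕ), J = Ideal.span ((fun m => monomial m (1 : k)) '' M)

/-- `J` is a lexsegment ideal: a monomial ideal that contains, with a monomial `m`, every monomial
`m'` of the same degree with `m ≼ m'` in the lexicographic order (in which `X 0 ≻ X 1 ≻ ⋯`). -/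
def IsLexsegment (J : Ideal (MvPolynomial (Fin n) k)) : Prop :=
  IsMonomialIdeal J ∧
    ∀ m m' : Fin n →₀ ℕ, monomial m (1 : k) ∈ J → m'.degree = m.degree →
      m ≼[MonomialOrder.lex] m' → monomial m' (1 : k) ∈ J

end Polynomials

section Loci

variable (k : Type*) [Field k] {n s : ℕ}

/-- The locus `U`: the points whose ideal has the smallest Hilbert function, in every degree. -/
def uLocus (n : ℕ) (d : Fin s → ℕ) : Set (Params k n d) :=
  {a | ∀ (b : Params k n d) (e : ℕ),
    hilbertFunction (idealOf a) e ≤ hilbertFunction (idealOf b) e}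

variable {k} in
/-- `V` is a Zariski open dense set, contained in `U`, on which the initial ideal is the same. -/
def IsGenericLocus (ord : MonomialOrder (Fin n)) (d : Fin s → ℕ) (V : Set (Params k n d)) : Prop :=
  IsZariskiOpen V ∧ IsZariskiDense V ∧ V ⊆ uLocus k n d ∧
    ∀ a ∈ V, ∀ b ∈ V, initialIdeal ord (idealOf a) = initialIdeal ord (idealOf b)

/-- The locus `V` of the points with `V`-generic ideals: the largest set as in `IsGenericLocus`
(any two such sets meet, so that the initial ideal is the same on their union). -/
def vLocus (ord : MonomialOrder (Fin n)) (d : Fin s → ℕ) : Set (Params k n d) :=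
  ⋃₀ {V | IsGenericLocus ord d V}

end Loci

end GenericIdeal

end

/-!
The generic initial ideal is determined degree by degree. Let `h e` be the number of monomials of
degree `e` divisible by none of the powers `X i ^ d i`, and let `B e` consist of the `h e`
lex-smallest monomials of degree `e`. The complements of the sets `B e` form the lexsegment ideal
with the Hilbert function of a complete intersection, and this is the generic initial ideal.

* For every choice of forms the Hilbert function of the quotient is at least `h`
  (`card_normalMons_le_hilbertFunction_subideal`). The forms are added one at a time; one form of
  degree `d` lowers the Hilbert function in degree `e` by at most the previous value in degree
  `e - d`, and this value is known for generic forms by semicontinuity, as the forms can be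
  specialized to powers of variables.
* That the monomials in `B e` span the degree `e` part of the quotient is an open condition
  (`generically_spans`). Where it holds, all other monomials of degree `e` are initial monomials,
  since `B e` is a lex-lower set, and by the bound on the Hilbert function no monomial of `B e` is
  one. From some degree `e₀` on the remaining conditions follow from those up to `e₀`. So there are
  finitely many open conditions, and it suffices that each of them holds somewhere
  (`isGenericLocus_and_isLexsegment`); different degrees may use different forms.
* The required ideals are explicit. If there is one form fewer than variables, take a grid of
  `∏ i, d i` points in the projective space, which is cut out by products of linear forms, in
  sufficiently general coordinates. The monomials in `B e` have linearly independent values on `h e`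
  points of the grid, hence they span the quotient (`exists_spans_of_det_ne_zero`). If there are as
  many forms as variables, take powers of general linear forms, and instead of values at points the
  coefficients at the monomials divisible by no `X i ^ d i`. In both cases the determinants are
  integers, and they are nonzero since they are nonzero modulo the prime `10007`, which is checked
  by elimination.
-/

noncomputable section

namespace GenericIdeal

/-! ### Conditions that hold generically -/

section Generic

variable {k : Type*} [Field k] {σ : Type*}

/-- The condition `p` holds on a nonempty principal open subset of the affine space `σ → k`. -/
def Generically (p : (σ → k) → Prop) : Prop :=
  ∃ P : MvPolynomial σ k, P ≠ 0 ∧ ∀ a, eval a P ≠ 0 → p a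

theorem Generically.and {p q : (σ → k) → Prop} (hp : Generically p) (hq : Generically q) :
    Generically fun a => p a ∧ q a := by
  obtain ⟨P, hP, hp⟩ := hp
  obtain ⟨Q, hQ, hq⟩ := hq
  refine ⟨P * Q, mul_ne_zero hP hQ, fun a ha => ?_⟩
  rw [map_mul] at ha
  exact ⟨hp a (left_ne_zero_of_mul ha), hq a (right_ne_zero_of_mul ha)⟩

theorem Generically.forall_finset {ι : Type*} (s : Finset ι) {p : ι → (σ → k) → Prop}
    (h : ∀ i ∈ s, Generically (p i)) : Generically fun a => ∀ i ∈ s, p i a := by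
  classical
  induction s using Finset.induction_on with
  | empty => exact ⟨1, one_ne_zero, fun a _ i hi => absurd hi (Finset.notMem_empty i)⟩
  | insert i s _ ih =>
    obtain ⟨P, hP, hp⟩ := (h i (Finset.mem_insert_self i s)).and
      (ih fun j hj => h j (Finset.mem_insert_of_mem hj))
    refine ⟨P, hP, fun a ha j hj => ?_⟩
    rcases Finset.mem_insert.1 hj with rfl | hj
    · exact (hp a ha).1
    · exact (hp a ha).2 j hj

theorem Generically.exists [Infinite k] {p : (σ → k) → Prop} (hp : Generically p) :
    ∃ a, p a := by
  obtain ⟨P, hP, hp⟩ := hp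
  by_contra! h
  refine hP (MvPolynomial.funext fun a => ?_)
  rw [map_zero]
  by_contra ha
  exact h a (hp a ha)

/-- Vectors that depend polynomially on a point and span the whole space at one point do so
generically: some maximal minor of their matrix is not the zero polynomial. -/
theorem generically_span_eq_top {ι J : Type*} [Fintype ι] (v : J → ι → MvPolynomial σ k)
    (a₀ : σ → k)
    (h : Submodule.span k (Set.range fun j i => eval a₀ (v j i)) = ⊤) :
    Generically fun a => Submodule.span k (Set.range fun j i => eval a (v j i)) = ⊤ := by
  classical
  obtain ⟨κ, f, -, hs, hl⟩ := exists_linearIndependent' k fun j i => eval a₀ (v j i)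
  rw [h] at hs
  let b := Module.Basis.mk hl hs.ge
  let e : ι ≃ κ := (Pi.basisFun k ι).indexEquiv b
  have key : ∀ a, (Matrix.of fun i j => v (f (e i)) j).det.eval a =
      (Matrix.of fun i j => (v (f (e i)) j).eval a).det := by
    intro a
    rw [RingHom.map_det]
    rfl
  refine ⟨(Matrix.of fun i j => v (f (e i)) j).det, ?_, fun a ha => ?_⟩
  · intro h0
    have h1 := key a₀
    rw [h0, map_zero] at h1
    have h2 : IsUnit (Matrix.of fun i j => (v (f (e i)) j).eval a₀) := by
      rw [← Matrix.linearIndependent_rows_iff_isUnit]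
      exact hl.comp e e.injective
    rw [Matrix.isUnit_iff_isUnit_det, ← h1] at h2
    exact not_isUnit_zero h2
  · rw [key] at ha
    have h2 : IsUnit (Matrix.of fun i j => (v (f (e i)) j).eval a) :=
      (Matrix.isUnit_iff_isUnit_det _).2 (isUnit_iff_ne_zero.2 ha)
    rw [← Matrix.linearIndependent_rows_iff_isUnit] at h2
    have h3 := h2.span_eq_top_of_card_eq_finrank' (by simp)
    refine top_unique (h3.ge.trans (Submodule.span_mono ?_))
    rintro _ ⟨i, rfl⟩
    exact ⟨f (e i), rfl⟩

end Generic

/-! ### Hilbert functions and spanning sets of graded pieces -/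

section Spans

variable {k : Type*} [Field k] {n : ℕ}

/-- The polynomials in `X` span the degree `e` part of the polynomial ring modulo `I`. -/
def Spans (I : Ideal (MvPolynomial (Fin n) k)) (e : ℕ) (X : Set (MvPolynomial (Fin n) k)) : Prop :=
  homogeneousSubmodule (Fin n) k e ≤ I.restrictScalars k ⊔ Submodule.span k X

/-- The monomials with exponents in `B`. -/
abbrev monomials (k : Type*) [Field k] {n : ℕ} (B : Set (Fin n →₀ ℕ)) :
    Set (MvPolynomial (Fin n) k) :=
  (fun m => monomial m 1) '' B

theorem mem_span_monomials {e : ℕ} {p : MvPolynomial (Fin n) k} (hp : p.IsHomogeneous e) :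
    p ∈ Submodule.span k (monomials k {m : Fin n →₀ ℕ | m.degree = e}) := by
  rw [p.as_sum]
  refine Submodule.sum_mem _ fun m hm => ?_
  rw [← mul_one (coeff m p), ← smul_eq_mul, ← smul_monomial]
  refine Submodule.smul_mem _ _ (Submodule.subset_span ⟨m, ?_, rfl⟩)
  by_contra h
  exact (mem_support_iff.1 hm) (hp.coeff_eq_zero h)

theorem span_monomials_le {e : ℕ} {B : Set (Fin n →₀ ℕ)} (hB : ∀ m ∈ B, m.degree = e) :
    Submodule.span k (monomials k B) ≤ homogeneousSubmodule (Fin n) k e := by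
  rw [Submodule.span_le]
  rintro _ ⟨m, hm, rfl⟩
  exact isHomogeneous_monomial 1 (hB m hm)

theorem coeff_eq_zero_of_mem_span_monomials {B : Set (Fin n →₀ ℕ)} {p : MvPolynomial (Fin n) k}
    (hp : p ∈ Submodule.span k (monomials k B)) {m : Fin n →₀ ℕ} (hm : m ∉ B) :
    coeff m p = 0 := by
  classical
  have : Submodule.span k (monomials k B) ≤ LinearMap.ker (lcoeff k m) := by
    rw [Submodule.span_le]
    rintro _ ⟨b, hb, rfl⟩
    simp only [SetLike.mem_coe, LinearMap.mem_ker, lcoeff_apply, coeff_monomial]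
    rw [if_neg]
    rintro rfl
    exact hm hb
  exact this hp

theorem spans_of_monomials {I : Ideal (MvPolynomial (Fin n) k)} {e : ℕ}
    {X : Set (MvPolynomial (Fin n) k)}
    (h : ∀ m : Fin n →₀ ℕ, m.degree = e →
      monomial m 1 ∈ I.restrictScalars k ⊔ Submodule.span k X) : Spans I e X := by
  intro p hp
  refine (Submodule.span_le.2 ?_ : _ ≤ I.restrictScalars k ⊔ Submodule.span k X)
    (mem_span_monomials hp)
  rintro _ ⟨m, hm, rfl⟩
  exact h m hm

theorem hilbertFunction_le_card {I : Ideal (MvPolynomial (Fin n) k)} {e : ℕ}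
    {X : Finset (MvPolynomial (Fin n) k)} (h : Spans I e X) : hilbertFunction I e ≤ X.card := by
  classical
  have h1 : (homogeneousSubmodule (Fin n) k e).map (Ideal.Quotient.mkₐ k I).toLinearMap ≤
      Submodule.span k (X.image (Ideal.Quotient.mkₐ k I).toLinearMap :
        Finset (MvPolynomial (Fin n) k ⧸ I)) := by
    refine (Submodule.map_mono h).trans ?_
    rw [Submodule.map_sup, Submodule.map_span, Finset.coe_image]
    refine sup_le ?_ le_rfl
    rintro _ ⟨p, hp, rfl⟩
    have : (Ideal.Quotient.mkₐ k I).toLinearMap p = 0 := Ideal.Quotient.eq_zero_iff_mem.2 hp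
    rw [this]
    exact zero_mem _
  exact (Submodule.finrank_mono h1).trans ((finrank_span_finset_le_card _).trans
    Finset.card_image_le)

theorem hilbertFunction_le_card_monomials {I : Ideal (MvPolynomial (Fin n) k)} {e : ℕ}
    {B : Finset (Fin n →₀ ℕ)} (h : Spans I e (monomials k B)) : hilbertFunction I e ≤ B.card := by
  classical
  refine (hilbertFunction_le_card (X := B.image fun m => monomial m 1) ?_).trans
    Finset.card_image_le
  rwa [Finset.coe_image]

/-- The value of the Hilbert function is attained by a set of monomials that span the graded
piece. -/
theorem exists_spans_monomials (I : Ideal (MvPolynomial (Fin n) k)) (e : ℕ) :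
    ∃ C : Finset (Fin n →₀ ℕ), (∀ m ∈ C, m.degree = e) ∧ C.card = hilbertFunction I e ∧
      Spans I e (monomials k C) := by
  classical
  let π := (Ideal.Quotient.mkₐ k I).toLinearMap
  have hmem : ∀ m : Fin n →₀ ℕ, m.degree = e ↔
      m ∈ (Finset.univ : Finset (Fin n)).finsuppAntidiag e := fun m => by
    simp [Finset.mem_finsuppAntidiag, Finsupp.degree_eq_sum]
  let v : Mon n e → MvPolynomial (Fin n) k ⧸ I := fun m => π (monomial m.1 1)
  have hv : Submodule.span k (Set.range v) = (homogeneousSubmodule (Fin n) k e).map π := by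
    apply le_antisymm
    · rw [Submodule.span_le]
      rintro _ ⟨m, rfl⟩
      exact ⟨_, isHomogeneous_monomial 1 ((hmem _).2 m.2), rfl⟩
    · rintro _ ⟨p, hp, rfl⟩
      have := Submodule.mem_map_of_mem (f := π) (mem_span_monomials hp)
      rw [Submodule.map_span] at this
      refine Submodule.span_mono ?_ this
      rintro _ ⟨_, ⟨m, hm, rfl⟩, rfl⟩
      exact ⟨⟨m, (hmem m).1 hm⟩, rfl⟩
  obtain ⟨κ, f, hf, hs, hl⟩ := exists_linearIndependent' k v
  have : Fintype κ := Fintype.ofInjective f hf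
  refine ⟨Finset.univ.image fun i => (f i).1, ?_, ?_, ?_⟩
  · intro m hm
    obtain ⟨i, -, rfl⟩ := Finset.mem_image.1 hm
    exact (hmem _).2 (f i).2
  · rw [Finset.card_image_of_injective (f := fun i => (f i).1) _
      (Subtype.val_injective.comp hf), Finset.card_univ, ← finrank_span_eq_card hl, hs, hv]
    rfl
  · intro p hp
    have hp' : π p ∈ Submodule.span k (Set.range (v ∘ f)) := by
      rw [hs, hv]; exact Submodule.mem_map_of_mem hp
    rw [Submodule.mem_span_range_iff_exists_fun] at hp'
    obtain ⟨c, hc⟩ := hp'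
    rw [← sub_add_cancel p (∑ i, c i • monomial (f i).1 1)]
    refine Submodule.add_mem_sup ?_ (Submodule.sum_mem _ fun i _ => Submodule.smul_mem _ _
      (Submodule.subset_span ⟨(f i).1, by simp, rfl⟩))
    refine Ideal.Quotient.eq_zero_iff_mem.1 ?_
    change π _ = 0
    rw [map_sub, ← hc, map_sum, sub_eq_zero]
    rfl

/-- Adding a form of degree `d` to a homogeneous ideal lowers the Hilbert function in degree
`e + d` by at most its value in degree `e`. -/
theorem hilbertFunction_add_le {I : Ideal (MvPolynomial (Fin n) k)}
    (hI : ∀ p ∈ I, ∀ e, homogeneousComponent e p ∈ I) {f : MvPolynomial (Fin n) k} {d : ℕ}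
    (hf : f.IsHomogeneous d) (e : ℕ) :
    hilbertFunction I (e + d) ≤
      hilbertFunction (I ⊔ Ideal.span {f}) (e + d) + hilbertFunction I e := by
  classical
  obtain ⟨C, hCd, hC, hCs⟩ := exists_spans_monomials (I ⊔ Ideal.span {f}) (e + d)
  obtain ⟨C', -, hC', hCs'⟩ := exists_spans_monomials I e
  let X : Finset (MvPolynomial (Fin n) k) :=
    C.image (fun m => monomial m 1) ∪ C'.image fun m => f * monomial m 1
  have hX : X.card ≤ hilbertFunction (I ⊔ Ideal.span {f}) (e + d) + hilbertFunction I e := by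
    rw [← hC, ← hC']
    exact (Finset.card_union_le _ _).trans
      (add_le_add Finset.card_image_le Finset.card_image_le)
  refine (hilbertFunction_le_card (X := X) ?_).trans hX
  intro p hp
  obtain ⟨u, hu, c, hc, rfl⟩ := Submodule.mem_sup.1 (hCs hp)
  obtain ⟨w, hw, g, hg, rfl⟩ := Submodule.mem_sup.1 (show u ∈ I ⊔ Ideal.span {f} from hu)
  obtain ⟨q, rfl⟩ := Ideal.mem_span_singleton'.1 hg
  have hc' : c ∈ homogeneousSubmodule (Fin n) k (e + d) := span_monomials_le hCd hc
  -- Only the components of `w` and `q` of the right degrees contribute to `p`.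
  have hdec : w + q * f + c = homogeneousComponent (e + d) w +
      homogeneousComponent e q * f + c := by
    have := homogeneousComponent_of_mem (m := e + d) hp
    rw [if_pos rfl, map_add, map_add, homogeneousComponent_of_mem hc', if_pos rfl] at this
    rw [← this]
    congr 2
    nth_rw 1 [← sum_homogeneousComponent q]
    rw [Finset.sum_mul, map_sum]
    have h1 : ∀ i, homogeneousComponent (e + d) (homogeneousComponent i q * f) =
        if i = e then homogeneousComponent i q * f else 0 := by
      intro i
      rw [homogeneousComponent_of_mem
        (((homogeneousComponent_isHomogeneous i q).mul hf : _ ∈ homogeneousSubmodule _ _ _))]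
      simp only [add_left_inj, eq_comm]
    rw [Finset.sum_congr rfl fun i _ => h1 i, Finset.sum_ite_eq']
    split_ifs with h
    · rfl
    · rw [homogeneousComponent_eq_zero, zero_mul]
      simpa using h
  rw [hdec]
  obtain ⟨w', hw', c', hc'', hq⟩ := Submodule.mem_sup.1 (hCs' (homogeneousComponent_mem e q))
  rw [← hq, add_mul, ← add_assoc, add_assoc (_ + _)]
  refine Submodule.add_mem_sup (I.add_mem (hI _ hw _) (I.mul_mem_right _ hw')) ?_
  refine add_mem ?_ (Submodule.span_mono ?_ hc)
  · have := Submodule.mem_map_of_mem (f := LinearMap.mulLeft k f) hc''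
    rw [Submodule.map_span, LinearMap.mulLeft_apply, mul_comm] at this
    refine Submodule.span_mono ?_ this
    rintro _ ⟨_, ⟨m, hm, rfl⟩, rfl⟩
    simp only [X, Finset.coe_union, Finset.coe_image]
    exact Or.inr ⟨m, hm, rfl⟩
  · simp only [X, Finset.coe_union, Finset.coe_image]
    exact Set.subset_union_left

end Spans

/-! ### The lower bound for the Hilbert function -/

section Forms

variable {k : Type*} [Field k] {n s : ℕ} {d : Fin s → ℕ}

theorem mem_finsuppAntidiag_iff_degree {m : Fin n →₀ ℕ} {e : ℕ} :
    m ∈ (Finset.univ : Finset (Fin n)).finsuppAntidiag e ↔ m.degree = e := by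
  simp [Finset.mem_finsuppAntidiag, Finsupp.degree_eq_sum]

theorem form_isHomogeneous (a : Params k n d) (i : Fin s) : (form a i).IsHomogeneous (d i) :=
  IsHomogeneous.sum _ _ _ fun m _ =>
    isHomogeneous_monomial _ (mem_finsuppAntidiag_iff_degree.1 m.2)

/-- Every family of forms of the prescribed degrees comes from a point of the parameter space. -/
theorem exists_form_eq (f : Fin s → MvPolynomial (Fin n) k)
    (hf : ∀ i, (f i).IsHomogeneous (d i)) : ∃ a : Params k n d, form a = f := by
  classical
  refine ⟨fun x => coeff x.2.1 (f x.1), funext fun i => ?_⟩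
  ext m
  rw [form, coeff_sum]
  simp only [coeff_monomial]
  by_cases hm : m.degree = d i
  · rw [Finset.sum_eq_single ⟨m, mem_finsuppAntidiag_iff_degree.2 hm⟩]
    · simp
    · intro b _ hb
      rw [if_neg]
      rintro rfl
      exact hb rfl
    · simp
  · rw [(hf i).coeff_eq_zero hm]
    refine Finset.sum_eq_zero fun b _ => ?_
    rw [if_neg]
    rintro rfl
    exact hm (mem_finsuppAntidiag_iff_degree.1 b.2)

/-- The ideal generated by the forms with indices in `T`. -/
abbrev subideal (a : Params k n d) (T : Set (Fin s)) : Ideal (MvPolynomial (Fin n) k) :=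
  Ideal.span (form a '' T)

theorem subideal_univ (a : Params k n d) : subideal a Set.univ = idealOf a := by
  rw [subideal, Set.image_univ, idealOf]

/-- The products of monomials and generators that are forms of degree `e`. -/
def gradedGenerators (a : Params k n d) (T : Set (Fin s)) (e : ℕ) :
    Set (MvPolynomial (Fin n) k) :=
  {p | ∃ i ∈ T, ∃ m : Fin n →₀ ℕ, m.degree + d i = e ∧ monomial m 1 * form a i = p}

theorem homogeneousComponent_mem_span_gradedGenerators {a : Params k n d} {T : Set (Fin s)}
    {p : MvPolynomial (Fin n) k} (hp : p ∈ subideal a T) (e : ℕ) :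
    homogeneousComponent e p ∈ Submodule.span k (gradedGenerators a T e) := by
  suffices ∀ q, homogeneousComponent e (q * p) ∈ Submodule.span k (gradedGenerators a T e) by
    simpa using this 1
  induction hp using Submodule.span_induction with
  | zero => intro q; rw [mul_zero, map_zero]; exact zero_mem _
  | add x y _ _ hx hy => intro q; rw [mul_add, map_add]; exact add_mem (hx q) (hy q)
  | smul r x _ ih => intro q; rw [smul_eq_mul, ← mul_assoc]; exact ih _
  | mem x hx =>
    obtain ⟨i, hi, rfl⟩ := hx
    intro q
    rw [q.as_sum, Finset.sum_mul, map_sum]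
    refine Submodule.sum_mem _ fun m _ => ?_
    have hm : monomial m (coeff m q) * form a i ∈
        homogeneousSubmodule (Fin n) k (m.degree + d i) :=
      (isHomogeneous_monomial _ rfl).mul (form_isHomogeneous a i)
    rw [homogeneousComponent_of_mem hm]
    split_ifs with h
    · have hc : monomial m (coeff m q) = coeff m q • monomial m (1 : k) := by
        rw [smul_monomial, smul_eq_mul, mul_one]
      rw [hc, smul_mul_assoc]
      exact Submodule.smul_mem _ _ (Submodule.subset_span ⟨i, hi, m, h.symm, rfl⟩)
    · exact zero_mem _

theorem gradedGenerators_subset (a : Params k n d) (T : Set (Fin s)) (e : ℕ) :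
    gradedGenerators a T e ⊆ subideal a T := by
  rintro _ ⟨i, hi, m, -, rfl⟩
  exact Ideal.mul_mem_left _ _ (Ideal.subset_span ⟨i, hi, rfl⟩)

theorem homogeneousComponent_mem_subideal {a : Params k n d} {T : Set (Fin s)}
    {p : MvPolynomial (Fin n) k} (hp : p ∈ subideal a T) (e : ℕ) :
    homogeneousComponent e p ∈ subideal a T :=
  (Submodule.span_le (p := (subideal a T).restrictScalars k)).2 (gradedGenerators_subset a T e)
    (homogeneousComponent_mem_span_gradedGenerators hp e)

variable (k n d) in
/-- The form of degree `d i` with indeterminate coefficients. -/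
def universalForm (i : Fin s) :
    MvPolynomial (Fin n) (MvPolynomial ((i : Fin s) × Mon n (d i)) k) :=
  ∑ m : Mon n (d i), monomial m.1 (X ⟨i, m⟩)

theorem map_universalForm (a : Params k n d) (i : Fin s) :
    map (eval a) (universalForm k n d i) = form a i := by
  simp [universalForm, form, map_sum, map_monomial]

/-- The property that the monomials in `B` span the degree `e` part modulo the forms with indices
in `T` is an open condition on the coefficients of the forms. -/
theorem generically_spans {T : Set (Fin s)} {e : ℕ} {B : Set (Fin n →₀ ℕ)}
    (hB : ∀ m ∈ B, m.degree = e) {a₀ : Params k n d}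
    (h₀ : Spans (subideal a₀ T) e (monomials k B)) :
    Generically fun a : Params k n d => Spans (subideal a T) e (monomials k B) := by
  classical
  -- The coefficient vectors of the graded generators and of the monomials in `B`.
  let J := {x : Fin s × (Fin n →₀ ℕ) // x.1 ∈ T ∧ x.2.degree + d x.1 = e} ⊕ B
  let v : J → Mon n e → MvPolynomial ((i : Fin s) × Mon n (d i)) k := fun j μ =>
    Sum.elim (fun x => coeff μ.1 (monomial x.1.2 1 * universalForm k n d x.1.1))
      (fun b => if b.1 = μ.1 then 1 else 0) j
  let κ : MvPolynomial (Fin n) k →ₗ[k] (Mon n e → k) := LinearMap.pi fun μ => lcoeff k μ.1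
  have hv : ∀ a : Params k n d, (Set.range fun j μ => eval a (v j μ)) =
      κ '' (gradedGenerators a T e ∪ monomials k B) := by
    intro a
    ext w
    constructor
    · rintro ⟨⟨⟨i, m⟩, hi, hm⟩ | ⟨b, hb⟩, rfl⟩
      · refine ⟨_, Or.inl ⟨i, hi, m, hm, rfl⟩, funext fun μ => ?_⟩
        simp only [κ, v, LinearMap.pi_apply, lcoeff_apply, Sum.elim_inl]
        rw [← map_universalForm, ← coeff_map, map_mul, map_monomial, map_one (eval a)]
      · refine ⟨_, Or.inr ⟨b, hb, rfl⟩, funext fun μ => ?_⟩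
        simp only [κ, v, LinearMap.pi_apply, lcoeff_apply, Sum.elim_inr, coeff_monomial]
        split_ifs <;> simp
    · rintro ⟨_, ⟨i, hi, m, hm, rfl⟩ | ⟨b, hb, rfl⟩, rfl⟩
      · refine ⟨Sum.inl ⟨⟨i, m⟩, hi, hm⟩, funext fun μ => ?_⟩
        simp only [κ, v, LinearMap.pi_apply, lcoeff_apply, Sum.elim_inl]
        rw [← map_universalForm, ← coeff_map, map_mul, map_monomial, map_one (eval a)]
      · refine ⟨Sum.inr ⟨b, hb⟩, funext fun μ => ?_⟩
        simp only [κ, v, LinearMap.pi_apply, lcoeff_apply, Sum.elim_inr, coeff_monomial]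
        split_ifs <;> simp
  have key : ∀ a : Params k n d, Spans (subideal a T) e (monomials k B) ↔
      Submodule.span k (Set.range fun j μ => eval a (v j μ)) = ⊤ := by
    intro a
    rw [hv, ← Submodule.map_span, Submodule.span_union]
    constructor
    · intro h
      rw [eq_top_iff]
      rintro w -
      let p : MvPolynomial (Fin n) k := ∑ μ : Mon n e, monomial μ.1 (w μ)
      have hp : p ∈ homogeneousSubmodule (Fin n) k e := Submodule.sum_mem _ fun μ _ =>
        isHomogeneous_monomial _ (mem_finsuppAntidiag_iff_degree.1 μ.2)
      have hκ : κ p = w := by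
        ext μ
        simp only [κ, p, LinearMap.pi_apply, lcoeff_apply, coeff_sum, coeff_monomial]
        rw [Finset.sum_eq_single μ]
        · simp
        · intro b _ hb
          rw [if_neg fun h => hb (Subtype.ext h)]
        · simp
      rw [← hκ]
      refine Submodule.mem_map_of_mem ?_
      obtain ⟨u, hu, c, hc, hpc⟩ := Submodule.mem_sup.1 (h hp)
      have := homogeneousComponent_of_mem (m := e) hp
      rw [if_pos rfl, ← hpc, map_add, homogeneousComponent_of_mem (span_monomials_le hB hc),
        if_pos rfl, hpc] at this
      rw [← this]
      exact Submodule.add_mem_sup (homogeneousComponent_mem_span_gradedGenerators hu e) hc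
    · intro h p hp
      have hp' : κ p ∈ Submodule.map κ (Submodule.span k (gradedGenerators a T e) ⊔
          Submodule.span k (monomials k B)) := by rw [h]; trivial
      obtain ⟨q, hq, hqp⟩ := hp'
      have hqe : q.IsHomogeneous e := by
        refine (sup_le (Submodule.span_le.2 ?_) (span_monomials_le hB) :
          _ ≤ homogeneousSubmodule (Fin n) k e) hq
        rintro _ ⟨i, -, m, hm, rfl⟩
        rw [← hm]
        exact (isHomogeneous_monomial 1 rfl).mul (form_isHomogeneous a i)
      have : q = p := by
        ext μ
        by_cases hμ : μ.degree = e
        · exact congrFun hqp ⟨μ, mem_finsuppAntidiag_iff_degree.2 hμ⟩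
        · rw [hqe.coeff_eq_zero hμ, IsHomogeneous.coeff_eq_zero hp hμ]
      rw [← this]
      refine (sup_le_sup_right ?_ _ : _ ≤ (subideal a T).restrictScalars k ⊔ _) hq
      exact Submodule.span_le.2 (gradedGenerators_subset a T e)
  rw [key] at h₀
  obtain ⟨P, hP, h⟩ := generically_span_eq_top v a₀ h₀
  exact ⟨P, hP, fun a ha => (key a).2 (h a ha)⟩

/-- The exponents of degree `e` of the monomials that are divisible by no `X j ^ d j` with
`j < i`. -/
def normalMons (hs : s ≤ n) (d : Fin s → ℕ) (i e : ℕ) : Finset (Fin n →₀ ℕ) :=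
  {m ∈ (Finset.univ : Finset (Fin n)).finsuppAntidiag e |
    ∀ j : Fin s, (j : ℕ) < i → m (Fin.castLE hs j) < d j}

theorem mem_normalMons {hs : s ≤ n} {i e : ℕ} {m : Fin n →₀ ℕ} :
    m ∈ normalMons hs d i e ↔
      m.degree = e ∧ ∀ j : Fin s, (j : ℕ) < i → m (Fin.castLE hs j) < d j := by
  rw [normalMons, Finset.mem_filter, mem_finsuppAntidiag_iff_degree]

theorem card_normalMons_le (hs : s ≤ n) (i : Fin s) (e : ℕ) :
    (normalMons hs d (i + 1) (e + d i)).card + (normalMons hs d i e).card ≤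
      (normalMons hs d i (e + d i)).card := by
  classical
  let φ : (Fin n →₀ ℕ) → (Fin n →₀ ℕ) := fun m => m + Finsupp.single (Fin.castLE hs i) (d i)
  have hφ : Function.Injective φ := fun _ _ h => add_right_cancel h
  rw [← Finset.card_image_of_injective (normalMons hs d i e) hφ, ← Finset.card_union_of_disjoint]
  · refine Finset.card_le_card (Finset.union_subset ?_ ?_)
    · intro m hm
      rw [mem_normalMons] at hm ⊢
      exact ⟨hm.1, fun j hj => hm.2 j (by omega)⟩
    · intro m hm
      obtain ⟨m, hm', rfl⟩ := Finset.mem_image.1 hm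
      rw [mem_normalMons] at hm' ⊢
      refine ⟨by rw [map_add, hm'.1, Finsupp.degree_single], fun j hj => ?_⟩
      have : Fin.castLE hs i ≠ Fin.castLE hs j := by
        intro h
        have := congrArg Fin.val h
        simp at this
        omega
      rw [Finsupp.add_apply, Finsupp.single_eq_of_ne' this, add_zero]
      exact hm'.2 j hj
  · rw [Finset.disjoint_right]
    intro m hm hm'
    obtain ⟨m, -, rfl⟩ := Finset.mem_image.1 hm
    have := (mem_normalMons.1 hm').2 i (by omega)
    rw [Finsupp.add_apply, Finsupp.single_eq_same] at this
    omega

/-- Modulo powers of variables, a graded piece is spanned by the monomials divisible by none of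
these powers. -/
theorem spans_normalMons_of_powers (hs : s ≤ n) {a : Params k n d}
    (ha : ∀ i, form a i = X (Fin.castLE hs i) ^ d i) (i e : ℕ) :
    Spans (subideal a {j | (j : ℕ) < i}) e
      (monomials k (normalMons hs d i e : Set (Fin n →₀ ℕ))) := by
  refine spans_of_monomials fun m hm => ?_
  by_cases h : m ∈ normalMons hs d i e
  · exact Submodule.mem_sup_right (Submodule.subset_span ⟨m, h, rfl⟩)
  · refine Submodule.mem_sup_left ?_
    rw [mem_normalMons] at h
    push Not at h
    obtain ⟨j, hj, hjm⟩ := h hm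
    have h1 : m = (m - Finsupp.single (Fin.castLE hs j) (d j)) +
        Finsupp.single (Fin.castLE hs j) (d j) :=
      (tsub_add_cancel_of_le (Finsupp.single_le_iff.2 hjm)).symm
    rw [h1, ← one_mul (1 : k), ← monomial_mul, ← X_pow_eq_monomial, ← ha]
    exact Ideal.mul_mem_left _ _ (Ideal.subset_span ⟨j, hj, rfl⟩)

theorem subideal_succ (a : Params k n d) (i : Fin s) :
    subideal a {j | (j : ℕ) < i + 1} = subideal a {j | (j : ℕ) < i} ⊔ Ideal.span {form a i} := by
  rw [subideal, subideal, ← Ideal.span_union, ← Set.image_singleton, ← Set.image_union]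
  congr 2
  ext j
  simp only [Set.mem_ofPred_eq, Set.mem_union, Set.mem_singleton_iff, Fin.ext_iff]
  omega

/-- The Hilbert function of an ideal generated by forms of given degrees is at least that of the
ideal generated by the corresponding powers of variables. The proof adds one form at a time: for
generic forms the Hilbert function of the ideal generated by the previous ones is known, and by
semicontinuity the resulting bound holds for all forms. -/
theorem card_normalMons_le_hilbertFunction_subideal [Infinite k] (hs : s ≤ n) (i : ℕ)
    (hi : i ≤ s) (b : Params k n d) (e : ℕ) :
    (normalMons hs d i e).card ≤ hilbertFunction (subideal b {j | (j : ℕ) < i}) e := by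
  classical
  obtain ⟨a₀, ha₀⟩ := exists_form_eq (k := k) (n := n) (d := d)
    (fun i => X (Fin.castLE hs i) ^ d i) fun i => isHomogeneous_X_pow _ _
  replace ha₀ := fun i => congrFun ha₀ i
  induction i generalizing b e with
  | zero =>
    obtain ⟨C, hC, hCc, hCs⟩ := exists_spans_monomials (subideal b {j | (j : ℕ) < 0}) e
    rw [← hCc]
    refine Finset.card_le_card fun m hm => ?_
    by_contra hmC
    have h1 := hCs (isHomogeneous_monomial (1 : k) (mem_normalMons.1 hm).1)
    have h2 : subideal b {j | (j : ℕ) < 0} = ⊥ := by simp [subideal]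
    rw [h2, Submodule.restrictScalars_bot, bot_sup_eq] at h1
    have := coeff_eq_zero_of_mem_span_monomials h1 (m := m) (by simpa using hmC)
    simp at this
  | succ i ih =>
    -- As few monomials as for `b` span the quotient for generic forms, too.
    obtain ⟨C, hC, hCc, hCs⟩ := exists_spans_monomials (subideal b {j | (j : ℕ) < i + 1}) e
    let i' : Fin s := ⟨i, hi⟩
    have hgen := generically_spans (B := (C : Set (Fin n →₀ ℕ))) hC hCs
    rcases lt_or_ge e (d i') with he | he
    -- In degrees below `d i` the new form does not matter.
    · rw [← hCc]
      have h1 : Spans (subideal b {j | (j : ℕ) < i}) e (monomials k C) := by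
        intro p hp
        obtain ⟨u, hu, c, hc, hpc⟩ := Submodule.mem_sup.1 (hCs hp)
        have := homogeneousComponent_of_mem (m := e) hp
        rw [if_pos rfl, ← hpc, map_add, homogeneousComponent_of_mem (span_monomials_le hC hc),
          if_pos rfl, hpc] at this
        rw [← this]
        refine Submodule.add_mem_sup ?_ hc
        refine (Submodule.span_le (p := (subideal b _).restrictScalars k)).2
          ((?_ : _ ⊆ gradedGenerators b {j | (j : ℕ) < i} e).trans
            (gradedGenerators_subset b _ e)) (homogeneousComponent_mem_span_gradedGenerators hu e)
        rintro _ ⟨j, hj, m, hm, rfl⟩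
        refine ⟨j, lt_of_le_of_ne (Nat.lt_succ_iff.1 hj) fun hji => ?_, m, hm, rfl⟩
        obtain rfl : j = i' := Fin.ext hji
        omega
      refine le_trans ?_ ((ih (by omega) b e).trans (hilbertFunction_le_card_monomials h1))
      refine Finset.card_le_card fun m hm => ?_
      rw [mem_normalMons] at hm ⊢
      exact ⟨hm.1, fun j hj => hm.2 j (by omega)⟩
    · obtain ⟨e, rfl⟩ := Nat.exists_eq_add_of_le' he
      have hgen' := generically_spans (fun m hm => (mem_normalMons.1 hm).1)
        (spans_normalMons_of_powers hs ha₀ i e)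
      obtain ⟨a, ha, ha'⟩ := (hgen.and hgen').exists
      have h1 := hilbertFunction_le_card_monomials ha
      have h2 := hilbertFunction_le_card_monomials ha'
      have h3 := ih (by omega) a (e + d i')
      have h4 := hilbertFunction_add_le (fun p hp e => homogeneousComponent_mem_subideal hp e)
        (form_isHomogeneous a i') (I := subideal a {j | (j : ℕ) < i}) e
      have h5 := card_normalMons_le (d := d) hs i' e
      have h6 := subideal_succ a i'
      change subideal a {j | (j : ℕ) < i + 1} = _ at h6
      rw [← h6] at h4
      change _ + (normalMons hs d i e).card ≤ (normalMons hs d i _).card at h5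
      change (normalMons hs d (i + 1) _).card + _ ≤ _ at h5
      omega

end Forms

/-! ### Initial ideals -/

section Initial

variable {k : Type*} [Field k] {n : ℕ} {ord : MonomialOrder (Fin n)}
  {I : Ideal (MvPolynomial (Fin n) k)} {e : ℕ} {B : Finset (Fin n →₀ ℕ)}

theorem initialIdeal_eq_span (ord : MonomialOrder (Fin n)) (I : Ideal (MvPolynomial (Fin n) k)) :
    initialIdeal ord I =
      Ideal.span ((fun m => monomial m (1 : k)) '' {m | ∃ f ∈ I, f ≠ 0 ∧ ord.degree f = m}) := by
  refine le_antisymm (Ideal.span_le.2 ?_) (Ideal.span_le.2 ?_)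
  · rintro _ ⟨f, hf, rfl⟩
    by_cases h0 : f = 0
    · rw [h0, ord.leadingTerm_zero]
      exact Ideal.zero_mem _
    · rw [MonomialOrder.leadingTerm, ← mul_one (ord.leadingCoeff f), ← C_mul_monomial]
      exact Ideal.mul_mem_left _ _ (Ideal.subset_span ⟨_, ⟨f, hf, h0, rfl⟩, rfl⟩)
  · rintro _ ⟨_, ⟨f, hf, h0, rfl⟩, rfl⟩
    have h1 : monomial (ord.degree f) (1 : k) =
        C (ord.leadingCoeff f)⁻¹ * ord.leadingTerm f := by
      rw [MonomialOrder.leadingTerm, C_mul_monomial,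
        inv_mul_cancel₀ (MonomialOrder.leadingCoeff_ne_zero_iff.2 h0)]
    simp only [SetLike.mem_coe]
    rw [h1]
    exact Ideal.mul_mem_left _ _ (Ideal.subset_span ⟨f, hf, rfl⟩)

theorem isMonomialIdeal_initialIdeal (ord : MonomialOrder (Fin n))
    (I : Ideal (MvPolynomial (Fin n) k)) : IsMonomialIdeal (initialIdeal ord I) :=
  ⟨_, initialIdeal_eq_span ord I⟩

theorem IsMonomialIdeal.le {J J' : Ideal (MvPolynomial (Fin n) k)} (hJ : IsMonomialIdeal J)
    (h : ∀ m, monomial m (1 : k) ∈ J → monomial m (1 : k) ∈ J') : J ≤ J' := by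
  obtain ⟨M, rfl⟩ := hJ
  rw [Ideal.span_le]
  rintro _ ⟨m, hm, rfl⟩
  exact h m (Ideal.subset_span ⟨m, hm, rfl⟩)

theorem monomial_mem_of_le {J : Ideal (MvPolynomial (Fin n) k)} {m m' : Fin n →₀ ℕ}
    (hm : monomial m (1 : k) ∈ J) (h : m ≤ m') : monomial m' (1 : k) ∈ J := by
  rw [← tsub_add_cancel_of_le h, ← one_mul (1 : k), ← monomial_mul]
  exact Ideal.mul_mem_left _ _ hm

/-- A monomial in the initial ideal of a homogeneous ideal is the initial monomial of a form. -/
theorem exists_form_of_monomial_mem_initialIdeal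
    (hI : ∀ p ∈ I, ∀ e, homogeneousComponent e p ∈ I) {m : Fin n →₀ ℕ}
    (hm : monomial m (1 : k) ∈ initialIdeal ord I) :
    ∃ g ∈ I, g.IsHomogeneous m.degree ∧ coeff m g = 1 ∧
      ∀ m', coeff m' g ≠ 0 → m' ≼[ord] m := by
  classical
  rw [initialIdeal_eq_span, mem_ideal_span_monomial_image] at hm
  obtain ⟨_, ⟨f, hf, h0, rfl⟩, hle⟩ := hm m (by simp)
  have hf1 : ord.degree (monomial (m - ord.degree f) (1 : k) * f) = m := by
    rw [ord.degree_mul (by simp) h0, ord.degree_monomial, if_neg one_ne_zero,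
      tsub_add_cancel_of_le hle]
  have hg0 : monomial (m - ord.degree f) (1 : k) * f ≠ 0 := mul_ne_zero (by simp) h0
  have hc := ord.coeff_degree_ne_zero_iff.2 hg0
  set g := monomial (m - ord.degree f) (1 : k) * f
  have hgI : g ∈ I := Ideal.mul_mem_left _ _ hf
  rw [hf1] at hc
  refine ⟨C (coeff m g)⁻¹ * homogeneousComponent m.degree g,
    Ideal.mul_mem_left _ _ (hI _ hgI _),
    (homogeneousComponent_isHomogeneous _ _).C_mul _, ?_, fun m' hm' => ?_⟩
  · rw [coeff_C_mul, coeff_homogeneousComponent, if_pos rfl, inv_mul_cancel₀ hc]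
  · rw [coeff_C_mul, coeff_homogeneousComponent] at hm'
    have := ord.le_degree (mem_support_iff.2 (show coeff m' g ≠ 0 by
      intro h
      simp [h] at hm'))
    rwa [hf1] at this

/-- If the monomials in a lower set span a graded piece modulo `I`, then all other monomials of
this degree are in the initial ideal. -/
theorem monomial_mem_initialIdeal_of_spans
    (hBl : ∀ m ∈ B, ∀ m' : Fin n →₀ ℕ, m'.degree = e → m' ≼[ord] m → m' ∈ B)
    (h : Spans I e (monomials k B)) {m : Fin n →₀ ℕ} (hm : m.degree = e) (hmB : m ∉ B) :
    monomial m (1 : k) ∈ initialIdeal ord I := by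
  classical
  obtain ⟨u, hu, c, hc, huc⟩ := Submodule.mem_sup.1 (h (isHomogeneous_monomial (1 : k) hm))
  have hcu : ∀ m', coeff m' u = (if m = m' then 1 else 0) - coeff m' c := fun m' => by
    rw [← coeff_monomial, ← huc, coeff_add, add_sub_cancel_right]
  have h1 : coeff m u = 1 := by
    rw [hcu, if_pos rfl, coeff_eq_zero_of_mem_span_monomials hc (by simpa using hmB), sub_zero]
  have hu0 : u ≠ 0 := by
    rintro rfl
    simp at h1
  have hdeg : ord.degree u = m := by
    apply ord.toSyn.injective
    refine le_antisymm ?_ (ord.le_degree (mem_support_iff.2 (by rw [h1]; exact one_ne_zero)))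
    rw [MonomialOrder.degree_le_iff]
    intro m' hm'
    by_cases hmm : m = m'
    · rw [hmm]
    · rw [mem_support_iff, hcu, if_neg hmm, zero_sub, neg_ne_zero] at hm'
      have hm'B : m' ∈ B := by
        by_contra hB
        exact hm' (coeff_eq_zero_of_mem_span_monomials hc (by simpa using hB))
      by_contra hlt
      exact hmB (hBl m' hm'B m hm (le_of_not_ge hlt))
  rw [initialIdeal_eq_span]
  exact Ideal.subset_span ⟨m, ⟨u, hu, hu0, hdeg⟩, rfl⟩

/-- If all monomials of degree `e` outside `B` are in the initial ideal, then the monomials in `B`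
span the graded piece modulo `I` (the division algorithm). -/
theorem spans_of_monomial_mem_initialIdeal
    (hI : ∀ p ∈ I, ∀ e, homogeneousComponent e p ∈ I)
    (h : ∀ m : Fin n →₀ ℕ, m.degree = e → m ∉ B → monomial m (1 : k) ∈ initialIdeal ord I) :
    Spans I e (monomials k B) := by
  classical
  refine spans_of_monomials fun m hm => ?_
  induction hx : ord.toSyn m using WellFoundedLT.induction generalizing m with
  | ind x ih =>
    subst hx
    by_cases hmB : m ∈ B
    · exact Submodule.mem_sup_right (Submodule.subset_span ⟨m, hmB, rfl⟩)
    obtain ⟨g, hg, hge, hg1, hgm⟩ := exists_form_of_monomial_mem_initialIdeal hI (h m hm hmB)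
    rw [← sub_add_cancel (monomial m (1 : k)) g]
    refine add_mem ?_ (Submodule.mem_sup_left hg)
    rw [(monomial m (1 : k) - g).as_sum]
    refine Submodule.sum_mem _ fun m' hm' => ?_
    rw [← mul_one (coeff m' _), ← smul_eq_mul, ← smul_monomial]
    refine Submodule.smul_mem _ _ (ih (ord.toSyn m') ?_ m' ?_ rfl)
    all_goals
      rw [mem_support_iff, coeff_sub, coeff_monomial] at hm'
      have hne : m ≠ m' := by
        rintro rfl
        simp [hg1] at hm'
      rw [if_neg hne, zero_sub, neg_ne_zero] at hm'
    · exact lt_of_le_of_ne (hgm m' hm') fun h => hne (ord.toSyn.injective h.symm)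
    · by_contra hd
      exact hm' (hge.coeff_eq_zero (by rwa [hm]))

/-- If the monomials in a lower set span a graded piece modulo `I` and are no more than the
dimension, then none of them is in the initial ideal. -/
theorem monomial_notMem_initialIdeal
    (hI : ∀ p ∈ I, ∀ e, homogeneousComponent e p ∈ I) (hBd : ∀ m ∈ B, m.degree = e)
    (hBl : ∀ m ∈ B, ∀ m' : Fin n →₀ ℕ, m'.degree = e → m' ≼[ord] m → m' ∈ B)
    (hBc : B.card ≤ hilbertFunction I e)
    (h : Spans I e (monomials k B)) {m : Fin n →₀ ℕ} (hmB : m ∈ B) :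
    monomial m (1 : k) ∉ initialIdeal ord I := by
  classical
  intro hm
  obtain ⟨g, hg, hge, hg1, hgm⟩ := exists_form_of_monomial_mem_initialIdeal hI hm
  rw [hBd m hmB] at hge
  have h1 : Spans I e (monomials k (B.erase m)) := by
    refine le_trans h (sup_le le_sup_left (Submodule.span_le.2 ?_))
    rintro _ ⟨b, hb, rfl⟩
    by_cases hbm : b = m
    · subst hbm
      simp only [SetLike.mem_coe]
      rw [← sub_add_cancel (monomial b (1 : k)) g]
      refine add_mem ?_ (Submodule.mem_sup_left hg)
      rw [(monomial b (1 : k) - g).as_sum]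
      refine Submodule.sum_mem _ fun m' hm' => ?_
      rw [← mul_one (coeff m' _), ← smul_eq_mul, ← smul_monomial]
      refine Submodule.smul_mem _ _ (Submodule.mem_sup_right (Submodule.subset_span
        ⟨m', ?_, rfl⟩))
      rw [mem_support_iff, coeff_sub, coeff_monomial] at hm'
      have hne : b ≠ m' := by
        rintro rfl
        simp [hg1] at hm'
      rw [if_neg hne, zero_sub, neg_ne_zero] at hm'
      refine Finset.mem_coe.2 (Finset.mem_erase.2 ⟨hne.symm, hBl b hmB m' ?_ (hgm m' hm')⟩)
      by_contra hd
      exact hm' (hge.coeff_eq_zero hd)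
    · exact Submodule.mem_sup_right (Submodule.subset_span
        ⟨b, Finset.mem_coe.2 (Finset.mem_erase.2 ⟨hbm, hb⟩), rfl⟩)
  have h2 := hilbertFunction_le_card_monomials h1
  have h3 := Finset.card_erase_lt_of_mem hmB
  omega

end Initial

/-! ### The locus of generic ideals -/

section Locus

variable {k : Type*} [Field k] {n s : ℕ} {d : Fin s → ℕ}

theorem isZariskiOpen_principal {σ : Type*} (P : MvPolynomial σ k) :
    IsZariskiOpen {a : σ → k | eval a P ≠ 0} := by
  refine ⟨Ideal.span {P}, ?_⟩
  ext a
  simp only [Set.mem_ofPred_eq, Set.mem_compl_iff, not_iff_not, mem_zeroLocus_iff]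
  constructor
  · intro h p hp
    obtain ⟨q, rfl⟩ := Ideal.mem_span_singleton'.1 hp
    change eval a (q * P) = 0
    rw [map_mul]
    exact mul_eq_zero_of_right _ h
  · intro h
    have := h P (Ideal.mem_span_singleton_self P)
    rwa [aeval_eq_eval] at this

theorem isZariskiDense_principal [Infinite k] {σ : Type*} {P : MvPolynomial σ k} (hP : P ≠ 0) :
    IsZariskiDense {a : σ → k | eval a P ≠ 0} := by
  intro T hT
  refine Set.eq_univ_of_forall fun a p hp => ?_
  have : p * P = 0 := by
    refine MvPolynomial.funext fun b => ?_
    rw [map_mul, map_zero]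
    by_cases hb : eval b P = 0
    · rw [hb, mul_zero]
    · have := hT hb p hp
      rw [aeval_eq_eval] at this
      change eval b p = 0 at this
      rw [this, zero_mul]
  rw [(mul_eq_zero.1 this).resolve_right hP, map_zero]

theorem IsZariskiOpen.sUnion {σ : Type*} {F : Set (Set (σ → k))}
    (hF : ∀ V ∈ F, IsZariskiOpen V) : IsZariskiOpen (⋃₀ F) := by
  refine ⟨sSup {T | (zeroLocus k T)ᶜ ∈ F}, ?_⟩
  ext a
  rw [← not_iff_not, Set.mem_compl_iff, not_not]
  constructor
  · intro h
    have hle : sSup {T | (zeroLocus k T)ᶜ ∈ F} ≤ RingHom.ker (eval a) := by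
      refine sSup_le fun T hT p hp => ?_
      by_contra hpa
      refine h ⟨_, hT, fun ha => hpa ?_⟩
      have := ha p hp
      rwa [aeval_eq_eval] at this
    intro p hp
    have := hle hp
    rw [aeval_eq_eval]
    exact this
  · rintro h ⟨V, hV, ha⟩
    obtain ⟨T, rfl⟩ := hF V hV
    exact ha fun p hp => h p ((le_sSup hV : T ≤ _) hp)

/-- Once there is some generic locus, the union of all of them is one. -/
theorem isGenericLocus_vLocus {ord : MonomialOrder (Fin n)} [Infinite k]
    {P : MvPolynomial ((i : Fin s) × Mon n (d i)) k} (hP : P ≠ 0)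
    (hW : IsGenericLocus ord d {a : Params k n d | eval a P ≠ 0}) :
    IsGenericLocus ord d (vLocus k ord d) ∧ ∀ a ∈ vLocus k ord d,
      ∃ w : Params k n d, eval w P ≠ 0 ∧
        initialIdeal ord (idealOf a) = initialIdeal ord (idealOf w) := by
  have key : ∀ a ∈ vLocus k ord d, ∃ w : Params k n d, eval w P ≠ 0 ∧
        initialIdeal ord (idealOf a) = initialIdeal ord (idealOf w) := by
    rintro a ⟨V, hV, ha⟩
    obtain ⟨w, hwV, hwP⟩ : ∃ w ∈ V, eval w P ≠ 0 := by
      by_contra! h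
      obtain ⟨T, hT⟩ := isZariskiOpen_principal P
      have h1 : V ⊆ zeroLocus k T := by
        intro w hw
        by_contra hwT
        have : w ∈ {a : Params k n d | eval a P ≠ 0} := hT ▸ hwT
        exact this (h w hw)
      have h2 := hV.2.1 T h1
      rw [h2, Set.compl_univ] at hT
      refine hP (MvPolynomial.funext fun b => ?_)
      rw [map_zero]
      by_contra hb
      have : b ∈ {a : Params k n d | eval a P ≠ 0} := hb
      rw [hT] at this
      exact this
    exact ⟨w, hwP, hV.2.2.2 a ha w hwV⟩
  refine ⟨⟨IsZariskiOpen.sUnion fun V hV => hV.1, fun T hT => hW.2.1 T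
    ((Set.subset_sUnion_of_mem hW).trans hT), Set.sUnion_subset fun V hV => hV.2.2.1,
    fun a ha b hb => ?_⟩, key⟩
  obtain ⟨w, hw, haw⟩ := key a ha
  obtain ⟨w', hw', hbw⟩ := key b hb
  rw [haw, hbw]
  exact hW.2.2.2 w hw w' hw'

/-- The criterion for generic initial ideals to be lexsegment ideals: in each degree `e`, let
`B e` be a set of lex-smallest monomials, no more than prescribed by the Hilbert function of a
complete intersection. If up to degree `e₀` some ideal has the monomials in `B e` as a spanning set
of the quotient, and from there on the monomials outside `B e` are multiples of those of degree
`e₀`, then the `B e` are the complements of the generic initial ideal. -/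
theorem isGenericLocus_and_isLexsegment [Infinite k] (hs : s ≤ n) (e₀ : ℕ)
    (B : ℕ → Finset (Fin n →₀ ℕ)) (hBd : ∀ e, ∀ m ∈ B e, m.degree = e)
    (hBl : ∀ e, ∀ m ∈ B e, ∀ m' : Fin n →₀ ℕ, m'.degree = e → m' ≼[MonomialOrder.lex] m →
      m' ∈ B e)
    (hBc : ∀ e, (B e).card ≤ (normalMons hs d s e).card)
    (hB₀ : ∀ e ≤ e₀, ∃ a : Params k n d, Spans (idealOf a) e (monomials k (B e)))
    (hB₁ : ∀ e, e₀ < e → ∀ m : Fin n →₀ ℕ, m.degree = e → m ∉ B e →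
      ∃ m' ≤ m, m'.degree = e₀ ∧ m' ∉ B e₀) :
    IsGenericLocus (k := k) (MonomialOrder.lex (σ := Fin n)) d
        (vLocus k (MonomialOrder.lex (σ := Fin n)) d) ∧
      ∀ a ∈ vLocus k (MonomialOrder.lex (σ := Fin n)) d,
        IsLexsegment (initialIdeal (MonomialOrder.lex (σ := Fin n)) (idealOf a)) := by
  obtain ⟨P, hP, hPB⟩ : Generically fun a : Params k n d =>
      ∀ e ∈ Finset.range (e₀ + 1), Spans (idealOf a) e (monomials k (B e)) := by
    refine Generically.forall_finset _ fun e he => ?_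
    obtain ⟨a, ha⟩ := hB₀ e (Nat.lt_succ_iff.1 (Finset.mem_range.1 he))
    rw [← subideal_univ] at ha
    simpa only [subideal_univ] using generically_spans (hBd e) ha
  have hI : ∀ a : Params k n d, ∀ p ∈ idealOf a, ∀ e, homogeneousComponent e p ∈ idealOf a := by
    intro a p hp e
    rw [← subideal_univ] at hp ⊢
    exact homogeneousComponent_mem_subideal hp e
  have hH : ∀ (a : Params k n d) (e : ℕ), (B e).card ≤ hilbertFunction (idealOf a) e := by
    intro a e
    have h1 := card_normalMons_le_hilbertFunction_subideal hs s le_rfl a e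
    have h2 : {j : Fin s | (j : ℕ) < s} = Set.univ := Set.eq_univ_of_forall fun j => j.2
    rw [h2, subideal_univ] at h1
    exact (hBc e).trans h1
  have hspan : ∀ a : Params k n d, eval a P ≠ 0 → ∀ e,
      Spans (idealOf a) e (monomials k (B e)) := by
    intro a ha e
    rcases le_or_gt e e₀ with he | he
    · exact hPB a ha e (Finset.mem_range.2 (Nat.lt_succ_iff.2 he))
    · refine spans_of_monomial_mem_initialIdeal (ord := MonomialOrder.lex (σ := Fin n)) (hI a)
        fun m hm hmB => ?_
      obtain ⟨m', hle, hm', hmB'⟩ := hB₁ e he m hm hmB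
      exact monomial_mem_of_le (monomial_mem_initialIdeal_of_spans (hBl e₀)
        (hPB a ha e₀ (Finset.self_mem_range_succ e₀)) hm' hmB') hle
  have hmem : ∀ a : Params k n d, eval a P ≠ 0 → ∀ m : Fin n →₀ ℕ,
      monomial m (1 : k) ∈ initialIdeal MonomialOrder.lex (idealOf a) ↔ m ∉ B m.degree :=
    fun a ha m => ⟨fun hm hmB => monomial_notMem_initialIdeal (hI a) (hBd _) (hBl _) (hH a _)
      (hspan a ha _) hmB hm, fun hmB => monomial_mem_initialIdeal_of_spans (hBl _) (hspan a ha _)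
      rfl hmB⟩
  have hW : IsGenericLocus MonomialOrder.lex d {a : Params k n d | eval a P ≠ 0} := by
    refine ⟨isZariskiOpen_principal P, isZariskiDense_principal hP, fun a ha b e => ?_,
      fun a ha b hb => le_antisymm ?_ ?_⟩
    · exact (hilbertFunction_le_card_monomials (hspan a ha e)).trans (hH b e)
    · exact (isMonomialIdeal_initialIdeal _ _).le fun m hm =>
        (hmem b hb m).2 ((hmem a ha m).1 hm)
    · exact (isMonomialIdeal_initialIdeal _ _).le fun m hm =>
        (hmem a ha m).2 ((hmem b hb m).1 hm)
  obtain ⟨h1, h2⟩ := isGenericLocus_vLocus hP hW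
  refine ⟨h1, fun a ha => ?_⟩
  obtain ⟨w, hw, haw⟩ := h2 a ha
  rw [haw]
  refine ⟨isMonomialIdeal_initialIdeal _ _, fun m m' hm hdeg hle => ?_⟩
  rw [hmem w hw] at hm ⊢
  rw [hdeg]
  exact fun hm' => hm (hBl _ m' hm' m rfl hle)

end Locus

/-! ### Spanning sets from independent functionals -/

section Witness

variable {k : Type*} [Field k] {n s : ℕ} {d : Fin s → ℕ}

/-- The linear substitution `X i ↦ ∑ j, A i j X j`. -/
def linSubst (A : Matrix (Fin n) (Fin n) k) :
    MvPolynomial (Fin n) k →ₐ[k] MvPolynomial (Fin n) k :=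
  aeval fun i => ∑ j, C (A i j) * X j

theorem linSubst_isHomogeneous (A : Matrix (Fin n) (Fin n) k) {p : MvPolynomial (Fin n) k} {e : ℕ}
    (hp : p.IsHomogeneous e) : (linSubst A p).IsHomogeneous e := by
  have := hp.aeval (n := 1) (fun i => ∑ j, C (A i j) * X j) fun i =>
    IsHomogeneous.sum _ _ _ fun j _ => isHomogeneous_C_mul_X _ _
  rwa [one_mul] at this

theorem linSubst_linSubst {A A' : Matrix (Fin n) (Fin n) k} (h : A * A' = 1)
    (p : MvPolynomial (Fin n) k) : linSubst A' (linSubst A p) = p := by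
  classical
  suffices (linSubst A').comp (linSubst A) = AlgHom.id k _ from DFunLike.congr_fun this p
  refine algHom_ext fun i => ?_
  have h1 : ∀ l, ∑ j, A i j * A' j l = if i = l then 1 else 0 := fun l => by
    rw [← Matrix.mul_apply, h, Matrix.one_apply]
  simp only [AlgHom.comp_apply, linSubst, aeval_X, map_sum, map_mul, algHom_C, algebraMap_eq,
    AlgHom.id_apply, Finset.mul_sum]
  rw [Finset.sum_comm]
  simp only [← mul_assoc, ← map_mul, ← Finset.sum_mul, ← map_sum, h1]
  simp

theorem linSubst_monomial (A : Matrix (Fin n) (Fin n) k) (m : Fin n →₀ ℕ) :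
    linSubst A (monomial m 1) = ∏ i, (∑ j, C (A i j) * X j) ^ m i := by
  rw [linSubst, aeval_monomial, map_one, one_mul, Finsupp.prod_fintype _ _ fun i => pow_zero _]

/-- If the initial monomials of the forms are the powers `X i ^ d i`, then the monomials divisible
by none of these powers span the graded pieces of the quotient. -/
theorem spans_normalMons (hs : s ≤ n) {a : Params k n d} (h0 : ∀ i, form a i ≠ 0)
    {ord : MonomialOrder (Fin n)}
    (ha : ∀ i, ord.degree (form a i) = Finsupp.single (Fin.castLE hs i) (d i)) (e : ℕ) :
    Spans (idealOf a) e (monomials k (normalMons hs d s e)) := by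
  refine spans_of_monomial_mem_initialIdeal (ord := ord) (fun p hp e => ?_) fun m hm hmN => ?_
  · rw [← subideal_univ] at hp ⊢
    exact homogeneousComponent_mem_subideal hp e
  · rw [mem_normalMons] at hmN
    push Not at hmN
    obtain ⟨j, -, hj⟩ := hmN hm
    refine monomial_mem_of_le (m := Finsupp.single (Fin.castLE hs j) (d j)) ?_
      (Finsupp.single_le_iff.2 hj)
    rw [initialIdeal_eq_span]
    exact Ideal.subset_span ⟨_, ⟨form a j, Ideal.subset_span ⟨j, rfl⟩, h0 j, ha j⟩, rfl⟩

/-- Let `g` be a point whose forms have the initial monomials `X i ^ d i`. If linear functionals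
that vanish on its ideal, as many as there are standard monomials of degree `e`, are independent
on the images of the monomials `μ u` under an invertible linear substitution, then some ideal has
these monomials as a spanning set of the degree `e` part of the quotient. -/
theorem exists_spans_of_det_ne_zero (hs : s ≤ n) {g : Params k n d} (h0 : ∀ i, form g i ≠ 0)
    {ord : MonomialOrder (Fin n)}
    (hg : ∀ i, ord.degree (form g i) = Finsupp.single (Fin.castLE hs i) (d i)) {e : ℕ}
    {A A' : Matrix (Fin n) (Fin n) k} (hA : A * A' = 1) {ι : Type*} [Fintype ι] [DecidableEq ι]
    (Λ : ι → MvPolynomial (Fin n) k →ₗ[k] k) (hΛ : ∀ t, ∀ p ∈ idealOf g, Λ t p = 0)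
    (hι : (normalMons hs d s e).card ≤ Fintype.card ι) (μ : ι → Fin n →₀ ℕ)
    (hμ : ∀ u, (μ u).degree = e)
    (hdet : (Matrix.of fun t u => Λ t (linSubst A (monomial (μ u) 1))).det ≠ 0)
    {B : Set (Fin n →₀ ℕ)} (hB : ∀ u, μ u ∈ B) :
    ∃ a : Params k n d, Spans (idealOf a) e (monomials k B) := by
  classical
  obtain ⟨a, ha⟩ := exists_form_eq (fun i => linSubst A' (form g i)) fun i =>
    linSubst_isHomogeneous A' (form_isHomogeneous g i)
  refine ⟨a, fun p hp => ?_⟩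
  let L : MvPolynomial (Fin n) k →ₗ[k] (ι → k) := LinearMap.pi Λ
  have hLI : ∀ p ∈ idealOf g, L p = 0 := fun p hp => funext fun t => hΛ t p hp
  set N := Submodule.span k (monomials k (normalMons hs d s e : Set (Fin n →₀ ℕ))) with hN
  have hspan := spans_normalMons hs h0 hg e
  set M := Matrix.of fun t u => Λ t (linSubst A (monomial (μ u) 1)) with hM
  have hsol : ∀ w : ι → k, ∃ c : ι → k, L (∑ u, c u • linSubst A (monomial (μ u) 1)) = w := by
    intro w
    refine ⟨M⁻¹.mulVec w, ?_⟩
    have h1 : M.mulVec (M⁻¹.mulVec w) = w := by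
      rw [Matrix.mulVec_mulVec, Matrix.mul_nonsing_inv _ (isUnit_iff_ne_zero.2 hdet),
        Matrix.one_mulVec]
    conv_rhs => rw [← h1]
    ext t
    rw [map_sum, Finset.sum_apply]
    simp only [map_smul, smul_eq_mul, L, LinearMap.pi_apply, Matrix.mulVec,
      dotProduct]
    exact Finset.sum_congr rfl fun u _ => mul_comm _ _
  have hhom : ∀ c : ι → k, (∑ u, c u • linSubst A (monomial (μ u) 1)).IsHomogeneous e :=
    fun c => Submodule.sum_mem (homogeneousSubmodule (Fin n) k e) fun u _ =>
      Submodule.smul_mem _ _ (linSubst_isHomogeneous A (isHomogeneous_monomial 1 (hμ u)))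
  -- `L` maps the span `N` of the standard monomials onto `ι → k`, so it is injective on `N`.
  have hsurj : Function.Surjective (L.domRestrict N) := by
    intro w
    obtain ⟨c, hc⟩ := hsol w
    obtain ⟨u, hu, r, hr, hur⟩ := Submodule.mem_sup.1 (hspan (hhom c))
    refine ⟨⟨r, hr⟩, ?_⟩
    rw [LinearMap.domRestrict_apply, ← hc, ← hur, map_add, hLI u hu, zero_add]
  have hfin : Module.Finite k N :=
    FiniteDimensional.span_of_finite k ((Finset.finite_toSet _).image _)
  have hcard : Module.finrank k N ≤ Fintype.card ι := by
    refine le_trans ?_ hι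
    rw [hN, monomials, ← Finset.coe_image]
    exact (finrank_span_finset_le_card _).trans Finset.card_image_le
  have hinj : LinearMap.ker (L.domRestrict N) = ⊥ := by
    have h1 := LinearMap.finrank_range_add_finrank_ker (L.domRestrict N)
    rw [LinearMap.range_eq_top.2 hsurj, finrank_top, Module.finrank_fintype_fun_eq_card] at h1
    exact Submodule.finrank_eq_zero.1 (by omega)
  have hker : ∀ q : MvPolynomial (Fin n) k, q.IsHomogeneous e → L q = 0 → q ∈ idealOf g := by
    intro q hq hLq
    obtain ⟨u, hu, r, hr, rfl⟩ := Submodule.mem_sup.1 (hspan hq)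
    have h1 : (⟨r, hr⟩ : N) ∈ LinearMap.ker (L.domRestrict N) := by
      rw [LinearMap.mem_ker, LinearMap.domRestrict_apply]
      rwa [map_add, hLI u hu, zero_add] at hLq
    rw [hinj, Submodule.mem_bot, Submodule.mk_eq_zero] at h1
    rw [h1, add_zero]
    exact hu
  obtain ⟨c, hc⟩ := hsol (L (linSubst A p))
  have h1 : linSubst A p - ∑ u, c u • linSubst A (monomial (μ u) 1) ∈ idealOf g := by
    refine hker _ ((linSubst_isHomogeneous A hp).sub (hhom c)) ?_
    rw [map_sub, hc, sub_self]
  have h2 : (idealOf g).map (linSubst A') = idealOf a := by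
    rw [idealOf, idealOf, Ideal.map_span, ← Set.range_comp, ha]
    rfl
  have h3 := Ideal.mem_map_of_mem (linSubst A') h1
  rw [h2, map_sub, map_sum, linSubst_linSubst hA] at h3
  simp only [map_smul, linSubst_linSubst hA] at h3
  rw [← sub_add_cancel p (∑ u, c u • monomial (μ u) 1)]
  exact Submodule.add_mem_sup h3 (Submodule.sum_mem _ fun u _ => Submodule.smul_mem _ _
    (Submodule.subset_span ⟨_, hB u, rfl⟩))

theorem degree_X_sub_C_mul_X {i l : Fin n} (hil : i < l) (c : k) :
    (MonomialOrder.lex (σ := Fin n)).degree (X i - C c * X l : MvPolynomial (Fin n) k) =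
      Finsupp.single i 1 := by
  classical
  have hlt : Finsupp.single l 1 ≺[MonomialOrder.lex] (Finsupp.single i 1 : Fin n →₀ ℕ) := by
    rw [MonomialOrder.lex_lt_iff]
    refine ⟨i, fun j hj => ?_, ?_⟩
    · simp only [ofLex_toLex]
      rw [Finsupp.single_eq_of_ne (hj.trans hil).ne, Finsupp.single_eq_of_ne hj.ne]
    · simp only [ofLex_toLex]
      rw [Finsupp.single_eq_same, Finsupp.single_eq_of_ne hil.ne]
      exact one_pos
  rw [sub_eq_add_neg, ← neg_mul, ← map_neg]
  have h1 : (MonomialOrder.lex (σ := Fin n)).degree (C (-c) * X l : MvPolynomial (Fin n) k)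
      ≺[MonomialOrder.lex]
        (MonomialOrder.lex (σ := Fin n)).degree (X i : MvPolynomial (Fin n) k) := by
    rw [MonomialOrder.degree_X, C_mul_X_eq_monomial]
    exact lt_of_le_of_lt (MonomialOrder.degree_monomial_le _) hlt
  rw [MonomialOrder.degree_add_of_lt h1, MonomialOrder.degree_X]

/-- Forms that are products of `d i` linear forms, with a rectangular grid as the common zero
locus. It has the coordinates `0, …, d i - 1` for `i < s` and the last coordinate `1`. -/
theorem exists_grid_forms (hs : s < n) (d : Fin s → ℕ) :
    ∃ g : Params k n d, (∀ i, form g i ≠ 0) ∧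
      (∀ i, (MonomialOrder.lex (σ := Fin n)).degree (form g i) =
        Finsupp.single (Fin.castLE hs.le i) (d i)) ∧
      ∀ x : Fin n → ℕ, (∀ i : Fin s, x (Fin.castLE hs.le i) < d i) →
        x ⟨n - 1, by omega⟩ = 1 → ∀ p ∈ idealOf g, eval (fun i => (x i : k)) p = 0 := by
  let f : Fin s → ℕ → MvPolynomial (Fin n) k := fun i j =>
    X (Fin.castLE hs.le i) - C (j : k) * X ⟨n - 1, by omega⟩
  have hf : ∀ i j, (MonomialOrder.lex (σ := Fin n)).degree (f i j) =
      Finsupp.single (Fin.castLE hs.le i) 1 := fun i j =>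
    degree_X_sub_C_mul_X (by simp [Fin.lt_def]; omega) _
  have hf0 : ∀ i j, f i j ≠ 0 := fun i j =>
    MonomialOrder.ne_zero_of_degree_ne_zero (m := MonomialOrder.lex) (by rw [hf]; simp)
  obtain ⟨g, hg⟩ := exists_form_eq (k := k) (n := n) (d := d)
    (fun i => ∏ j ∈ Finset.range (d i), f i j) fun i => by
      have := IsHomogeneous.prod (Finset.range (d i)) (f i) (fun _ => 1) fun j _ =>
        (isHomogeneous_X _ _).sub (isHomogeneous_C_mul_X _ _)
      simpa using this
  refine ⟨g, fun i => ?_, fun i => ?_, fun x hx hx1 p hp => ?_⟩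
  · rw [hg]
    exact Finset.prod_ne_zero_iff.2 fun j _ => hf0 i j
  · rw [hg, MonomialOrder.degree_prod fun j _ => hf0 i j]
    simp [hf]
  · have : idealOf g ≤ RingHom.ker (eval fun i => (x i : k)) := by
      rw [idealOf, Ideal.span_le]
      rintro _ ⟨i, rfl⟩
      rw [hg, SetLike.mem_coe, RingHom.mem_ker, map_prod]
      refine Finset.prod_eq_zero (Finset.mem_range.2 (hx i)) ?_
      simp [f, hx1]
    exact this hp

/-- Powers of variables: the functionals that take the coefficients at the monomials divisible by
none of these powers vanish on their ideal. -/
theorem exists_power_forms (hs : s ≤ n) (d : Fin s → ℕ) :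
    ∃ g : Params k n d, (∀ i, form g i ≠ 0) ∧
      (∀ i, (MonomialOrder.lex (σ := Fin n)).degree (form g i) =
        Finsupp.single (Fin.castLE hs i) (d i)) ∧
      ∀ m : Fin n →₀ ℕ, (∀ i : Fin s, m (Fin.castLE hs i) < d i) →
        ∀ p ∈ idealOf g, coeff m p = 0 := by
  classical
  obtain ⟨g, hg⟩ := exists_form_eq (k := k) (n := n) (d := d)
    (fun i => X (Fin.castLE hs i) ^ d i) fun i => isHomogeneous_X_pow _ _
  refine ⟨g, fun i => ?_, fun i => ?_, fun m hm p hp => ?_⟩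
  · rw [hg]
    exact pow_ne_zero _ (X_ne_zero _)
  · rw [hg, MonomialOrder.degree_pow, MonomialOrder.degree_X]
    simp
  · have h1 : idealOf g = Ideal.span ((fun m => monomial m (1 : k)) ''
        (Set.range fun i => Finsupp.single (Fin.castLE hs i) (d i))) := by
      rw [idealOf, hg, ← Set.range_comp]
      congr 2
      ext1 i
      exact X_pow_eq_monomial
    rw [h1, mem_ideal_span_monomial_image] at hp
    by_contra hc
    obtain ⟨_, ⟨i, rfl⟩, hi⟩ := hp m (mem_support_iff.2 hc)
    exact (hm i).not_ge (Finsupp.single_le_iff.1 hi)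

end Witness

/-! ### Lists of monomials -/

section Lists

/-- The exponents (as lists of length `n`) of the monomials of degree `e` whose first exponents are
less than the entries of `d`, in increasing lexicographic order. -/
def monsList : ℕ → List ℕ → ℕ → List (List ℕ)
  | 0, _, 0 => [[]]
  | 0, _, _ + 1 => []
  | n + 1, [], e => (List.range (e + 1)).flatMap fun j => (monsList n [] (e - j)).map (j :: ·)
  | n + 1, c :: d, e =>
    (List.range (min c (e + 1))).flatMap fun j => (monsList n d (e - j)).map (j :: ·)

/-- As many of the lex-smallest monomials of degree `e` as there are monomials of degree `e` with
exponents bounded by `d`. -/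
def lexFirst (n : ℕ) (d : List ℕ) (e : ℕ) : List (List ℕ) :=
  (monsList n [] e).take (monsList n d e).length

theorem mem_monsList {n : ℕ} {d : List ℕ} {e : ℕ} {l : List ℕ} :
    l ∈ monsList n d e ↔ l.length = n ∧ l.sum = e ∧
      ∀ i < n, i < d.length → l.getD i 0 < d.getD i 0 := by
  induction n generalizing d e l with
  | zero => cases e <;> cases l <;> simp [monsList]
  | succ n ih =>
    cases d with
    | nil =>
      simp only [monsList, List.mem_flatMap, List.mem_range, List.mem_map, ih]
      constructor
      · rintro ⟨j, hj, l, ⟨rfl, hl, -⟩, rfl⟩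
        simp
        omega
      · rintro ⟨h1, h2, -⟩
        cases l with
        | nil => simp at h1
        | cons a l =>
          simp only [List.length_cons, add_left_inj, List.sum_cons] at h1 h2
          exact ⟨a, by omega, l, ⟨h1, by omega, by simp⟩, rfl⟩
    | cons c d =>
      simp only [monsList, List.mem_flatMap, List.mem_range, List.mem_map, ih]
      constructor
      · rintro ⟨j, hj, l, ⟨rfl, hl, h⟩, rfl⟩
        refine ⟨by simp, by simp; omega, fun i hi hid => ?_⟩
        cases i with
        | zero => simp; omega
        | succ i =>
          simp only [List.getD_cons_succ]
          exact h i (by omega) (by simpa using hid)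
      · rintro ⟨h1, h2, h3⟩
        cases l with
        | nil => simp at h1
        | cons a l =>
          simp only [List.length_cons, add_left_inj, List.sum_cons] at h1 h2
          have h4 := h3 0 (by omega) (by simp)
          simp only [List.getD_cons_zero] at h4
          refine ⟨a, by omega, l, ⟨h1, by omega, fun i hi hid => ?_⟩, rfl⟩
          have := h3 (i + 1) (by omega) (by simpa using hid)
          simpa using this

/-- The strict lexicographic order on lists of exponents. -/
def LexLT (l l' : List ℕ) : Prop :=
  ∃ i, (∀ j < i, l.getD j 0 = l'.getD j 0) ∧ l.getD i 0 < l'.getD i 0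

theorem pairwise_flatMap_cons {f : ℕ → List (List ℕ)} (hf : ∀ j, (f j).Pairwise LexLT) (c : ℕ) :
    ((List.range c).flatMap fun j => (f j).map (j :: ·)).Pairwise LexLT := by
  rw [List.pairwise_flatMap]
  refine ⟨fun j _ => ?_, (List.pairwise_lt_range (n := c)).imp fun {a b} hab x hx y hy => ?_⟩
  · rw [List.pairwise_map]
    refine (hf j).imp fun {a b} => ?_
    rintro ⟨i, h1, h2⟩
    refine ⟨i + 1, fun j hj => ?_, by simpa using h2⟩
    cases j with
    | zero => simp
    | succ j => simpa using h1 j (by omega)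
  · obtain ⟨x, -, rfl⟩ := List.mem_map.1 hx
    obtain ⟨y, -, rfl⟩ := List.mem_map.1 hy
    exact ⟨0, by simp, by simpa using hab⟩

theorem pairwise_monsList (n : ℕ) (d : List ℕ) (e : ℕ) : (monsList n d e).Pairwise LexLT := by
  induction n generalizing d e with
  | zero => cases e <;> simp [monsList]
  | succ n ih =>
    cases d with
    | nil => exact pairwise_flatMap_cons (fun j => ih [] (e - j)) _
    | cons c d => exact pairwise_flatMap_cons (fun j => ih d (e - j)) _

theorem nodup_monsList (n : ℕ) (d : List ℕ) (e : ℕ) : (monsList n d e).Nodup := by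
  refine (pairwise_monsList n d e).imp ?_
  rintro a _ ⟨i, -, h⟩ rfl
  exact h.false

theorem length_monsList_le (n : ℕ) (d : List ℕ) (e : ℕ) :
    (monsList n d e).length ≤ (monsList n [] e).length := by
  refine ((nodup_monsList n d e).subperm fun l hl => ?_).length_le
  rw [mem_monsList] at hl ⊢
  exact ⟨hl.1, hl.2.1, by simp⟩

theorem length_lexFirst (n : ℕ) (d : List ℕ) (e : ℕ) :
    (lexFirst n d e).length = (monsList n d e).length := by
  rw [lexFirst, List.length_take, min_eq_left (length_monsList_le n d e)]

variable {n s : ℕ} {d : Fin s → ℕ}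

/-- The exponent with the entries of a list. -/
def expo (n : ℕ) (l : List ℕ) : Fin n →₀ ℕ :=
  Finsupp.equivFunOnFinite.symm fun i => l.getD i 0

@[simp]
theorem expo_apply (l : List ℕ) (i : Fin n) : expo n l i = l.getD i 0 := rfl

theorem expo_ofFn (m : Fin n →₀ ℕ) : expo n (List.ofFn m) = m := by
  ext i
  simp [List.getD_eq_getElem?_getD]

theorem degree_expo {l : List ℕ} (hl : l.length = n) : (expo n l).degree = l.sum := by
  subst hl
  rw [Finsupp.degree_eq_sum, ← Fin.sum_univ_getElem]
  exact Finset.sum_congr rfl fun i _ => by simp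

theorem expo_injOn {l l' : List ℕ} (hl : l.length = n) (hl' : l'.length = n)
    (h : expo n l = expo n l') : l = l' := by
  refine List.ext_getElem (hl.trans hl'.symm) fun i h1 h2 => ?_
  have := DFunLike.congr_fun h ⟨i, hl ▸ h1⟩
  simpa [h1, h2] using this

theorem LexLT.expo {l l' : List ℕ} (hl : l'.length = n) (h : LexLT l l') :
    expo n l ≺[MonomialOrder.lex] expo n l' := by
  obtain ⟨i, h1, h2⟩ := h
  have hi : i < n := by
    by_contra hi
    rw [List.getD_eq_default l' 0 (by omega)] at h2
    omega
  rw [MonomialOrder.lex_lt_iff]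
  exact ⟨⟨i, hi⟩, fun j hj => h1 j hj, h2⟩

theorem getD_ofFn (d : Fin s → ℕ) (i : Fin s) : (List.ofFn d).getD i 0 = d i := by
  rw [List.getD_eq_getElem _ _ (by simp), List.getElem_ofFn]

theorem normalMons_eq (hs : s ≤ n) (d : Fin s → ℕ) (e : ℕ) :
    normalMons hs d s e = ((monsList n (List.ofFn d) e).map (expo n)).toFinset := by
  ext m
  rw [mem_normalMons, List.mem_toFinset, List.mem_map]
  constructor
  · rintro ⟨h1, h2⟩
    refine ⟨List.ofFn m, mem_monsList.2 ⟨by simp, ?_, fun i hi hid => ?_⟩, expo_ofFn m⟩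
    · rw [List.sum_ofFn, ← h1, Finsupp.degree_eq_sum]
    · rw [List.length_ofFn] at hid
      have := h2 ⟨i, hid⟩ hid
      simpa [hi, hid, List.getD_eq_getElem?_getD] using this
  · rintro ⟨l, hl, rfl⟩
    obtain ⟨h1, h2, h3⟩ := mem_monsList.1 hl
    refine ⟨(degree_expo h1).trans h2, fun j _ => ?_⟩
    have := h3 j (by omega) (by simp)
    simpa [List.getD_eq_getElem?_getD] using this

theorem card_normalMons (hs : s ≤ n) (d : Fin s → ℕ) (e : ℕ) :
    (normalMons hs d s e).card = (monsList n (List.ofFn d) e).length := by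
  rw [normalMons_eq, List.toFinset_card_of_nodup, List.length_map]
  exact (nodup_monsList n _ e).map_on fun l hl l' hl' h =>
    expo_injOn (mem_monsList.1 hl).1 (mem_monsList.1 hl').1 h

theorem mem_monsList_of_mem_lexFirst {d : List ℕ} {e : ℕ} {l : List ℕ} (h : l ∈ lexFirst n d e) :
    l.length = n ∧ l.sum = e := by
  have := mem_monsList.1 (List.mem_of_mem_take h)
  exact ⟨this.1, this.2.1⟩

theorem mem_lexFirst_of_le {d : List ℕ} {e : ℕ} {l : List ℕ} (h : l ∈ lexFirst n d e)
    {m : Fin n →₀ ℕ} (hm : m.degree = e) (hle : m ≼[MonomialOrder.lex] expo n l) :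
    List.ofFn m ∈ lexFirst n d e := by
  have h1 : List.ofFn m ∈ monsList n [] e := mem_monsList.2
    ⟨by simp, by rw [List.sum_ofFn, ← hm, Finsupp.degree_eq_sum], by simp⟩
  have h2 := pairwise_monsList n [] e
  rw [← List.take_append_drop (monsList n d e).length (monsList n [] e)] at h1 h2
  rcases List.mem_append.1 h1 with h1 | h1
  · exact h1
  · have h3 := ((List.pairwise_append.1 h2).2.2 l h _ h1).expo (n := n) (by simp)
    rw [expo_ofFn] at h3
    exact absurd hle h3.not_ge

end Lists

/-! ### Elimination modulo a prime -/

section Elimination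

/-- Entrywise `a * x + b * y` modulo `p` (a list is continued by zeros). It is written with
recursors and the basic operations on natural numbers, since the kernel has to evaluate it many
times. -/
def rowOp (p a b : ℕ) (l : List ℕ) : List ℕ → List ℕ :=
  List.rec (fun ys => ys.map fun y => Nat.mod (Nat.mul b y) p)
    (fun x _ ih ys => List.rec (Nat.mod (Nat.mul a x) p :: ih [])
      (fun y ys _ => Nat.mod (Nat.add (Nat.mul a x) (Nat.mul b y)) p :: ih ys) ys) l

/-- Clears the first entry of a row by means of the pivot row `a :: r`, and drops this entry. -/
def elimRow (p a : ℕ) (r : List ℕ) : List ℕ → List ℕ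
  | [] => []
  | b :: q => rowOp p a (Nat.sub p (Nat.mod b p)) q r

/-- Gaussian elimination modulo `p` without interchanges of rows, on the leading `h × h` block,
meets only nonzero pivots. -/
def regularMod (p : ℕ) : ℕ → List (List ℕ) → Bool
  | 0, _ => true
  | _ + 1, [] => false
  | _ + 1, [] :: _ => false
  | h + 1, (a :: r) :: rows =>
    !Nat.beq (Nat.mod a p) 0 && regularMod p h (rows.map (elimRow p a r))

variable {p : ℕ}

theorem getD_rowOp (a b : ℕ) (l l' : List ℕ) (j : ℕ) :
    ((rowOp p a b l l').getD j 0 : ZMod p) = a * l.getD j 0 + b * l'.getD j 0 := by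
  induction l generalizing l' j with
  | nil =>
    have h : rowOp p a b [] l' = l'.map fun y => (b * y) % p := rfl
    rw [h]
    rcases lt_or_ge j l'.length with hj | hj
    · simp [List.getD_eq_getElem?_getD, hj]
    · simp [List.getD_eq_getElem?_getD, hj]
  | cons x xs ih =>
    cases l' with
    | nil =>
      have h : rowOp p a b (x :: xs) [] = (a * x) % p :: rowOp p a b xs [] := rfl
      rw [h]
      cases j with
      | zero => simp
      | succ j => simpa using ih [] j
    | cons y ys =>
      have h : rowOp p a b (x :: xs) (y :: ys) = (a * x + b * y) % p :: rowOp p a b xs ys := rfl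
      rw [h]
      cases j with
      | zero => simp
      | succ j => simpa using ih ys j

theorem getD_elimRow [NeZero p] (a : ℕ) (r q : List ℕ) (j : ℕ) :
    ((elimRow p a r q).getD j 0 : ZMod p) = a * q.getD (j + 1) 0 - q.getD 0 0 * r.getD j 0 := by
  cases q with
  | nil => simp [elimRow]
  | cons b q =>
    have h : ((Nat.sub p (Nat.mod b p) : ℕ) : ZMod p) = -b := by
      change ((p - b % p : ℕ) : ZMod p) = -b
      rw [Nat.cast_sub (Nat.mod_lt _ (NeZero.pos p)).le]
      simp
    rw [elimRow, getD_rowOp, h]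
    simp
    ring

theorem eq_zero_of_regularMod [Fact p.Prime] {h : ℕ} {rows : List (List ℕ)}
    (hr : regularMod p h rows = true) (c : ℕ → ZMod p)
    (hc : ∀ j < h, ∑ i ∈ Finset.range h, c i * ((rows.getD i []).getD j 0 : ℕ) = 0) :
    ∀ i < h, c i = 0 := by
  induction h generalizing rows c with
  | zero => intro i hi; omega
  | succ h ih =>
    match rows, hr with
    | (a :: r) :: rows, hr =>
      rw [regularMod, Bool.and_eq_true] at hr
      have ha : (a : ZMod p) ≠ 0 := by
        intro ha
        have h1 : a % p = 0 := Nat.mod_eq_zero_of_dvd ((ZMod.natCast_eq_zero_iff _ _).1 ha)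
        have h2 : (!Nat.beq (a % p) 0) = true := hr.1
        rw [h1] at h2
        exact absurd h2 (by decide)
      simp only [Finset.sum_range_succ', List.getD_cons_succ, List.getD_cons_zero] at hc
      have h1 : ∀ i < h, c (i + 1) = 0 := by
        refine ih hr.2 (fun i => c (i + 1)) fun j hj => ?_
        have h2 : ∀ i, ((((rows.map (elimRow p a r)).getD i []).getD j 0 : ℕ) : ZMod p) =
            a * ((rows.getD i []).getD (j + 1) 0 : ℕ) -
              ((rows.getD i []).getD 0 0 : ℕ) * (r.getD j 0 : ℕ) := by
          intro i
          rw [← getD_elimRow]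
          have : (rows.map (elimRow p a r)).getD i [] = elimRow p a r (rows.getD i []) :=
            List.getD_map rows [] (elimRow p a r)
          rw [this]
        have h3 := hc 0 (by omega)
        have h4 := hc (j + 1) (by omega)
        simp only [List.getD_cons_zero, List.getD_cons_succ] at h3 h4
        simp only [h2, mul_sub, Finset.sum_sub_distrib]
        have h5 : ∑ i ∈ Finset.range h, c (i + 1) * ((a : ZMod p) *
            ((rows.getD i []).getD (j + 1) 0 : ℕ)) =
            a * ∑ i ∈ Finset.range h, c (i + 1) * ((rows.getD i []).getD (j + 1) 0 : ℕ) := by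
          rw [Finset.mul_sum]
          exact Finset.sum_congr rfl fun i _ => by ring
        have h6 : ∑ i ∈ Finset.range h, c (i + 1) * (((rows.getD i []).getD 0 0 : ℕ) *
            (r.getD j 0 : ZMod p)) =
            r.getD j 0 * ∑ i ∈ Finset.range h, c (i + 1) * ((rows.getD i []).getD 0 0 : ℕ) := by
          rw [Finset.mul_sum]
          exact Finset.sum_congr rfl fun i _ => by ring
        rw [h5, h6]
        linear_combination (a : ZMod p) * h4 - (r.getD j 0 : ZMod p) * h3
      intro i hi
      cases i with
      | zero =>
        have h3 := hc 0 (by omega)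
        rw [Finset.sum_eq_zero fun i hi => by rw [h1 i (Finset.mem_range.1 hi), zero_mul],
          zero_add] at h3
        simpa [ha] using h3
      | succ i => exact h1 i (by omega)

theorem det_map_natCast {h : ℕ} (M : Matrix (Fin h) (Fin h) ℕ) (R : Type*) [CommRing R] :
    (M.map (Nat.cast : ℕ → R)).det = ((M.map (Nat.cast : ℕ → ℤ)).det : R) := by
  rw [Int.cast_det]
  congr 1
  ext i j
  simp

/-- A matrix of natural numbers that is regular modulo a prime is regular in characteristic
zero. -/
theorem det_ne_zero_of_regularMod [Fact p.Prime] {h : ℕ} {rows : List (List ℕ)}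
    (hr : regularMod p h rows = true) (M : Matrix (Fin h) (Fin h) ℕ)
    (hM : ∀ i j, (M i j : ZMod p) = ((rows.getD i []).getD j 0 : ℕ))
    (k : Type*) [Field k] [CharZero k] : (M.map (Nat.cast : ℕ → k)).det ≠ 0 := by
  have h1 : (M.map (Nat.cast : ℕ → ZMod p)).det ≠ 0 := by
    intro h0
    obtain ⟨v, hv, hv0⟩ := Matrix.exists_vecMul_eq_zero_iff.2 h0
    refine hv (funext fun i => ?_)
    have := eq_zero_of_regularMod hr (fun i => if hi : i < h then v ⟨i, hi⟩ else 0)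
      (fun j hj => ?_) i i.2
    · simpa using this
    · have h2 := congrFun hv0 ⟨j, hj⟩
      rw [Finset.sum_range]
      simpa [Matrix.vecMul, dotProduct, hM] using h2
  have h3 : (M.map (Nat.cast : ℕ → ℤ)).det ≠ 0 := by
    intro h0
    rw [det_map_natCast, h0, Int.cast_zero] at h1
    exact h1 rfl
  rw [det_map_natCast]
  exact Int.cast_ne_zero.2 h3

end Elimination

/-! ### Explicit ideals -/

section Grid

variable {k : Type*} [Field k] [CharZero k] {n s : ℕ} {d : Fin s → ℕ}

/-- The finite set of exponents listed by `lexFirst`. -/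
def lexFirstMons (n : ℕ) (d : List ℕ) (e : ℕ) : Finset (Fin n →₀ ℕ) :=
  ((lexFirst n d e).map (expo n)).toFinset

theorem mem_lexFirstMons {d : List ℕ} {e : ℕ} {m : Fin n →₀ ℕ} :
    m ∈ lexFirstMons n d e ↔ ∃ l ∈ lexFirst n d e, expo n l = m := by
  rw [lexFirstMons, List.mem_toFinset, List.mem_map]

/-- The matrix with the given rows. -/
def rowsMatrix (R : Type*) [NatCast R] (n : ℕ) (A : List (List ℕ)) : Matrix (Fin n) (Fin n) R :=
  Matrix.of fun i j => ((A.getD i []).getD j 0 : R)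

theorem rowsMatrix_mul_eq_one {A : List (List ℕ)} {A' : Matrix (Fin n) (Fin n) ℤ}
    (h : rowsMatrix ℤ n A * A' = 1) (k : Type*) [Field k] :
    rowsMatrix k n A * A'.map (Int.cast : ℤ → k) = 1 := by
  have h1 := congrArg (fun M => M.map (Int.castRingHom k)) h
  simp only [Matrix.map_mul] at h1
  rw [Matrix.map_one _ (map_zero _) (map_one _)] at h1
  rw [← h1]
  congr 1
  ext i j
  simp [rowsMatrix]

/-- The scalar product of two lists. -/
def dot : List ℕ → List ℕ → ℕ
  | a :: l, b :: m => Nat.add (Nat.mul a b) (dot l m)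
  | _, _ => 0

/-- The product of the powers of the entries of a list with exponents from another list. As
`rowOp`, it is written with recursors for the sake of the kernel. -/
def powProd (l : List ℕ) : List ℕ → ℕ :=
  List.rec (fun _ => 1)
    (fun a _ ih m => List.rec 1 (fun b m _ => Nat.mul (Nat.pow a b) (ih m)) m) l

theorem dot_eq {l m : List ℕ} {n : ℕ} (hl : l.length = n) :
    dot l m = ∑ i : Fin n, l.getD i 0 * m.getD i 0 := by
  subst hl
  induction l generalizing m with
  | nil => simp [dot]
  | cons a l ih =>
    cases m with
    | nil => simp [dot]
    | cons b m =>
      have : dot (a :: l) (b :: m) = a * b + dot l m := rfl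
      rw [this, ih]
      simp [Fin.sum_univ_succ]

theorem powProd_eq {l m : List ℕ} {n : ℕ} (hl : l.length = n) (hm : m.length = n) :
    powProd l m = ∏ i : Fin n, l.getD i 0 ^ m.getD i 0 := by
  subst hl
  induction l generalizing m with
  | nil => simp [powProd]
  | cons a l ih =>
    cases m with
    | nil => simp at hm
    | cons b m =>
      have : powProd (a :: l) (b :: m) = a ^ b * powProd l m := rfl
      rw [this, ih (by simpa using hm)]
      simp [Fin.prod_univ_succ]

/-- The matrix, modulo `p`, of the values of the functionals indexed by `N` at the monomials in
`L`, when `entry b m` is the value for `b` and `m`. -/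
def entryRows (p : ℕ) (entry : List ℕ → List ℕ → ℕ) (N L : List (List ℕ)) : List (List ℕ) :=
  N.map fun b => L.map fun m => Nat.mod (entry b m) p

/-- The criterion `exists_spans_of_det_ne_zero` for the lex-smallest monomials, with the
determinant computed modulo a prime. -/
theorem exists_spans_of_regularMod {p : ℕ} [Fact p.Prime] (hs : s ≤ n) {g : Params k n d}
    (h0 : ∀ i, form g i ≠ 0) {ord : MonomialOrder (Fin n)}
    (hg : ∀ i, ord.degree (form g i) = Finsupp.single (Fin.castLE hs i) (d i))
    {A A' : Matrix (Fin n) (Fin n) k} (hA : A * A' = 1) {e : ℕ}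
    (Λ : List ℕ → MvPolynomial (Fin n) k →ₗ[k] k)
    (hΛ : ∀ b ∈ monsList n (List.ofFn d) e, ∀ q ∈ idealOf g, Λ b q = 0)
    {entry : List ℕ → List ℕ → ℕ}
    (hentry : ∀ b ∈ monsList n (List.ofFn d) e, ∀ m ∈ lexFirst n (List.ofFn d) e,
      Λ b (linSubst A (monomial (expo n m) 1)) = entry b m)
    {N L : List (List ℕ)} (hN : N.Perm (monsList n (List.ofFn d) e))
    (hL : L.Perm (lexFirst n (List.ofFn d) e))
    (hr : regularMod p N.length (entryRows p entry N L) = true) :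
    ∃ a : Params k n d,
      Spans (idealOf a) e (monomials k (lexFirstMons n (List.ofFn d) e)) := by
  have hLN : L.length = N.length := by
    rw [hL.length_eq, hN.length_eq, length_lexFirst]
  have hNt : ∀ t : Fin N.length, N[t] ∈ monsList n (List.ofFn d) e := fun t =>
    hN.subset (List.getElem_mem _)
  have hLu : ∀ u : Fin N.length, L[u] ∈ lexFirst n (List.ofFn d) e := fun u =>
    hL.subset (List.getElem_mem _)
  refine exists_spans_of_det_ne_zero hs h0 hg hA (fun t : Fin N.length => Λ N[t])
    (fun t => hΛ _ (hNt t)) (by rw [card_normalMons, Fintype.card_fin, hN.length_eq])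
    (fun u => expo n L[u]) (fun u => ?_) ?_ (fun u => mem_lexFirstMons.2 ⟨_, hLu u, rfl⟩)
  · obtain ⟨h1, h2⟩ := mem_monsList_of_mem_lexFirst (hLu u)
    rw [degree_expo h1, h2]
  · have h1 := det_ne_zero_of_regularMod hr (Matrix.of fun t u => entry N[t] L[u])
      (fun t u => ?_) k
    · convert h1 using 2
      ext t u
      exact hentry _ (hNt t) _ (hLu u)
    · have h2 : ((entryRows p entry N L).getD t []).getD u 0 = entry N[t] L[u] % p := by
        have ht : (t : ℕ) < (entryRows p entry N L).length := by simp [entryRows]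
        rw [List.getD_eq_getElem _ _ ht]
        simp only [entryRows, List.getElem_map]
        rw [List.getD_eq_getElem _ _ (by simp [hLN]), List.getElem_map]
        rfl
      rw [h2, ZMod.natCast_mod]
      rfl

/-- The grid point with the same first `s` coordinates as `b`. -/
def gridPoint (s : ℕ) (b : List ℕ) : List ℕ :=
  b.take s ++ [1]

/-- The value of the monomial with exponents `m`, in the coordinates given by the rows of `A`, at
a grid point. -/
def gridEntry (s : ℕ) (A : List (List ℕ)) (b m : List ℕ) : ℕ :=
  powProd (A.map (dot (gridPoint s b))) m

/-- The points of a grid as functionals, in the coordinates given by an invertible integral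
matrix. -/
theorem exists_spans_of_grid {p : ℕ} [Fact p.Prime] (hs : s + 1 = n)
    {A : List (List ℕ)} (hA : A.length = n) {A' : Matrix (Fin n) (Fin n) ℤ}
    (hAA' : rowsMatrix ℤ n A * A' = 1) {e : ℕ}
    (hr : regularMod p (monsList n (List.ofFn d) e).length (entryRows p (gridEntry s A)
      (monsList n (List.ofFn d) e) (lexFirst n (List.ofFn d) e)) = true) :
    ∃ a : Params k n d,
      Spans (idealOf a) e (monomials k (lexFirstMons n (List.ofFn d) e)) := by
  obtain ⟨g, hg0, hg, hgx⟩ := exists_grid_forms (k := k) (show s < n by omega) d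
  have hlen : ∀ b ∈ monsList n (List.ofFn d) e, (gridPoint s b).length = n := fun b hb => by
    have := (mem_monsList.1 hb).1
    simp [gridPoint]
    omega
  refine exists_spans_of_regularMod (by omega) hg0 hg (rowsMatrix_mul_eq_one hAA' k)
    (fun b => (aeval fun i : Fin n => (((gridPoint s b).getD i 0 : ℕ) : k)).toLinearMap)
    (fun b hb q hq => ?_) (fun b hb m hm => ?_) (List.Perm.refl _) (List.Perm.refl _) hr
  · change aeval _ q = 0
    obtain ⟨h1, -, h3⟩ := mem_monsList.1 hb
    rw [aeval_eq_eval]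
    refine hgx (fun i => (gridPoint s b).getD i 0) (fun i => ?_) ?_ q hq
    · have h4 := h3 i (by omega) (by simp)
      rw [gridPoint, Fin.val_castLE, List.getD_append _ _ _ _ (by simp; omega)]
      simpa [List.getD_eq_getElem?_getD, List.getElem?_take] using h4
    · rw [gridPoint]
      simp only
      rw [List.getD_append_right _ _ _ _ (by simp; omega)]
      have : n - 1 - (b.take s).length = 0 := by simp; omega
      rw [this]
      rfl
  · have h2 := (mem_monsList_of_mem_lexFirst hm).1
    have h3 : ∀ i, (A.map (dot (gridPoint s b))).getD i 0 = dot (gridPoint s b) (A.getD i []) :=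
      fun i => by
        have h4 : dot (gridPoint s b) [] = 0 := by cases h : gridPoint s b <;> rfl
        rw [← h4]
        exact List.getD_map A [] (dot (gridPoint s b))
    rw [gridEntry, powProd_eq (show (A.map (dot (gridPoint s b))).length = n by simp [hA]) h2]
    simp only [AlgHom.toLinearMap_apply, linSubst_monomial, h3,
      dot_eq (hlen b hb), map_prod, map_pow, map_sum, map_mul, aeval_X, rowsMatrix, Nat.cast_prod,
      Nat.cast_pow, Nat.cast_sum, Nat.cast_mul, expo_apply, algHom_C, Algebra.algebraMap_self,
      RingHom.id_apply, Matrix.of_apply]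
    exact Finset.prod_congr rfl fun i _ => congrArg (· ^ _)
      (Finset.sum_congr rfl fun j _ => mul_comm _ _)

/-- The coefficients of `(r₀ X₀ + r₁ X₁ + r₂ X₂) q`, as a function of the exponents, in terms of
those of `q`. -/
def linMulCoeff (r : List ℕ) (F : ℕ → ℕ → ℕ → ℕ) (i j l : ℕ) : ℕ :=
  Nat.add (Nat.add (match i with | 0 => 0 | i + 1 => Nat.mul (r.getD 0 0) (F i j l))
    (match j with | 0 => 0 | j + 1 => Nat.mul (r.getD 1 0) (F i j l)))
    (match l with | 0 => 0 | l + 1 => Nat.mul (r.getD 2 0) (F i j l))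

/-- The coefficients of `(r₀ X₀ + r₁ X₁ + r₂ X₂) ^ t q` in terms of those of `q`. -/
def linPowCoeff (r : List ℕ) : ℕ → (ℕ → ℕ → ℕ → ℕ) → ℕ → ℕ → ℕ → ℕ
  | 0, F => F
  | t + 1, F => linMulCoeff r (linPowCoeff r t F)

/-- The coefficient with exponents `b` of the monomial with exponents `m` in the linear forms given
by the rows of `A`. -/
def powerEntry (A : List (List ℕ)) (b m : List ℕ) : ℕ :=
  linPowCoeff (A.getD 0 []) (m.getD 0 0) (linPowCoeff (A.getD 1 []) (m.getD 1 0)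
    (linPowCoeff (A.getD 2 []) (m.getD 2 0)
      fun i j l => match i, j, l with | 0, 0, 0 => 1 | _, _, _ => 0))
    (b.getD 0 0) (b.getD 1 0) (b.getD 2 0)

/-- `F` gives the coefficients of `q`. -/
def IsCoeff (q : MvPolynomial (Fin 3) k) (F : ℕ → ℕ → ℕ → ℕ) : Prop :=
  ∀ m : Fin 3 →₀ ℕ, coeff m q = F (m 0) (m 1) (m 2)

theorem IsCoeff.linMul {q : MvPolynomial (Fin 3) k} {F : ℕ → ℕ → ℕ → ℕ} (h : IsCoeff q F)
    (r : List ℕ) :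
    IsCoeff ((∑ j : Fin 3, C (r.getD j 0 : k) * X j) * q) (linMulCoeff r F) := by
  intro m
  have key : ∀ j : Fin 3, coeff m (C (r.getD j 0 : k) * X j * q) =
      ((if m j = 0 then 0 else r.getD j 0 * F ((m - Finsupp.single j 1 : Fin 3 →₀ ℕ) 0)
        ((m - Finsupp.single j 1 : Fin 3 →₀ ℕ) 1)
        ((m - Finsupp.single j 1 : Fin 3 →₀ ℕ) 2) : ℕ) : k) := by
    intro j
    rw [mul_assoc, coeff_C_mul, mul_comm (X j), coeff_mul_X', h]
    simp only [Finsupp.mem_support_iff]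
    split_ifs <;> simp_all
  rw [Finset.sum_mul, coeff_sum]
  have hmatch : ∀ (x a : ℕ) (f : ℕ → ℕ), (if x = 0 then 0 else a * f (x - 1)) =
      match x with | 0 => 0 | x + 1 => Nat.mul a (f x) := fun x a f => by cases x <;> rfl
  have h0 := hmatch (m 0) (r.getD 0 0) fun i => F i (m 1) (m 2)
  have h1 := hmatch (m 1) (r.getD 1 0) fun j => F (m 0) j (m 2)
  have h2 := hmatch (m 2) (r.getD 2 0) fun l => F (m 0) (m 1) l
  have h3 : linMulCoeff r F (m 0) (m 1) (m 2) = _ + _ + _ :=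
    (congrArg₂ _ (congrArg₂ _ h0 h1) h2).symm
  rw [h3]
  simp only [key, Fin.sum_univ_three, ← Nat.cast_add]
  simp

theorem IsCoeff.linPow {q : MvPolynomial (Fin 3) k} {F : ℕ → ℕ → ℕ → ℕ} (h : IsCoeff q F)
    (r : List ℕ) (t : ℕ) :
    IsCoeff ((∑ j : Fin 3, C (r.getD j 0 : k) * X j) ^ t * q) (linPowCoeff r t F) := by
  induction t with
  | zero => simpa [linPowCoeff] using h
  | succ t ih =>
    rw [pow_succ', mul_assoc]
    exact ih.linMul r

/-- The coefficients modulo powers of variables as functionals, in the coordinates given by an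
invertible integral matrix. -/
theorem exists_spans_of_powers {d : Fin 3 → ℕ} {p : ℕ} [Fact p.Prime] {A : List (List ℕ)}
    {A' : Matrix (Fin 3) (Fin 3) ℤ} (hAA' : rowsMatrix ℤ 3 A * A' = 1) {e : ℕ}
    (hr : regularMod p (monsList 3 (List.ofFn d) e).reverse.length (entryRows p (powerEntry A)
      (monsList 3 (List.ofFn d) e).reverse (lexFirst 3 (List.ofFn d) e).reverse) = true) :
    ∃ a : Params k 3 d,
      Spans (idealOf a) e (monomials k (lexFirstMons 3 (List.ofFn d) e)) := by
  obtain ⟨g, hg0, hg, hgx⟩ := exists_power_forms (k := k) le_rfl d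
  refine exists_spans_of_regularMod le_rfl hg0 hg (rowsMatrix_mul_eq_one hAA' k)
    (fun b => lcoeff k (expo 3 b))
    (fun b hb q hq => ?_) (fun b hb m hm => ?_) (List.reverse_perm _) (List.reverse_perm _) hr
  · refine hgx (expo 3 b) (fun i => ?_) q hq
    have h4 := (mem_monsList.1 hb).2.2 i i.2 (by simp)
    rw [getD_ofFn] at h4
    exact h4
  · have h1 : IsCoeff (1 : MvPolynomial (Fin 3) k)
        fun i j l => match i, j, l with | 0, 0, 0 => 1 | _, _, _ => 0 := by
      intro m
      rw [coeff_one]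
      have h2 : 0 = m ↔ m 0 = 0 ∧ m 1 = 0 ∧ m 2 = 0 := by
        rw [eq_comm, Finsupp.ext_iff, Fin.forall_fin_succ, Fin.forall_fin_succ,
          Fin.forall_fin_one]
        rfl
      simp only [h2]
      rcases m 0 with _ | _ <;> rcases m 1 with _ | _ <;> rcases m 2 with _ | _ <;> simp
    have h2 := ((h1.linPow (A.getD 2 []) (m.getD 2 0)).linPow (A.getD 1 []) (m.getD 1 0)).linPow
      (A.getD 0 []) (m.getD 0 0) (expo 3 b)
    rw [linSubst_monomial, Fin.prod_univ_three]
    rw [mul_one] at h2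
    rw [mul_assoc]
    exact h2

end Grid

/-! ### High degrees and the conclusion -/

section Tail

variable {k : Type*} [Field k] [CharZero k] {n s : ℕ} {d : Fin s → ℕ}

/-- The exponents of degree `e` in the last two variables only, with the exponent of the last but
one less than `D`. -/
def tailMons (n D e : ℕ) : Finset (Fin n →₀ ℕ) :=
  {m ∈ (Finset.univ : Finset (Fin n)).finsuppAntidiag e |
    ∀ i : Fin n, ((i : ℕ) + 2 < n → m i = 0) ∧ ((i : ℕ) + 2 = n → m i < D)}

theorem mem_tailMons {D e : ℕ} {m : Fin n →₀ ℕ} : m ∈ tailMons n D e ↔ m.degree = e ∧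
    ∀ i : Fin n, ((i : ℕ) + 2 < n → m i = 0) ∧ ((i : ℕ) + 2 = n → m i < D) := by
  rw [tailMons, Finset.mem_filter, mem_finsuppAntidiag_iff_degree]

theorem card_tailMons_le (hn : 2 ≤ n) (D e : ℕ) : (tailMons n D e).card ≤ D := by
  classical
  refine (Finset.card_le_card_of_injOn (t := Finset.range D) (fun m => m ⟨n - 2, by omega⟩)
    (fun m hm => ?_) fun m hm m' hm' h => ?_).trans_eq (Finset.card_range D)
  · exact Finset.mem_coe.2 (Finset.mem_range.2
      (((mem_tailMons.1 hm).2 _).2 (Nat.sub_add_cancel hn)))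
  · obtain ⟨h1, h2⟩ := mem_tailMons.1 hm
    obtain ⟨h1', h2'⟩ := mem_tailMons.1 hm'
    have hne : ∀ i ≠ (⟨n - 1, by omega⟩ : Fin n), m i = m' i := by
      intro i hi
      have hi' : (i : ℕ) ≠ n - 1 := fun h => hi (Fin.ext h)
      rcases lt_or_ge ((i : ℕ) + 2) n with h3 | h3
      · rw [(h2 i).1 h3, (h2' i).1 h3]
      · have : i = ⟨n - 2, by omega⟩ := Fin.ext (by simp; omega)
        rw [this]
        exact h
    ext i
    by_cases hi : i = ⟨n - 1, by omega⟩
    · rw [hi]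
      rw [← h1', Finsupp.degree_eq_sum, Finsupp.degree_eq_sum,
        ← Finset.add_sum_erase _ _ (Finset.mem_univ (⟨n - 1, by omega⟩ : Fin n)),
        ← Finset.add_sum_erase _ (fun i => m' i)
          (Finset.mem_univ (⟨n - 1, by omega⟩ : Fin n)),
        Finset.sum_congr rfl fun i hi => hne i (Finset.ne_of_mem_erase hi)] at h1
      exact add_right_cancel h1
    · exact hne i hi

theorem mem_tailMons_of_le {D e : ℕ} {m m' : Fin n →₀ ℕ} (hm : m ∈ tailMons n D e)
    (hm' : m'.degree = e) (h : m' ≼[MonomialOrder.lex] m) : m' ∈ tailMons n D e := by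
  rw [MonomialOrder.lex_le_iff] at h
  rcases h.eq_or_lt with h | h
  · rwa [toLex_inj.1 h]
  · obtain ⟨j, hj, hjlt⟩ := h
    simp only [ofLex_toLex] at hj hjlt
    obtain ⟨-, h2⟩ := mem_tailMons.1 hm
    have hjn : n ≤ (j : ℕ) + 2 := by
      by_contra hjn
      rw [(h2 j).1 (by omega)] at hjlt
      omega
    refine mem_tailMons.2 ⟨hm', fun i => ⟨fun hi => ?_, fun hi => ?_⟩⟩
    · rw [hj i (Fin.lt_def.2 (by omega))]
      exact (h2 i).1 hi
    · rcases lt_or_ge i j with hij | hij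
      · rw [hj i hij]
        exact (h2 i).2 hi
      · obtain rfl : i = j := le_antisymm (Fin.le_def.2 (by omega)) hij
        exact hjlt.trans ((h2 i).2 hi)

theorem exists_degree_eq_of_le {l m : Fin n →₀ ℕ} (hlm : l ≤ m) {e : ℕ} (hl : l.degree ≤ e)
    (hm : e ≤ m.degree) : ∃ m', l ≤ m' ∧ m' ≤ m ∧ m'.degree = e := by
  obtain ⟨t, ht⟩ := Nat.exists_eq_add_of_le hm
  induction t generalizing m with
  | zero => exact ⟨m, hlm, le_rfl, ht⟩
  | succ t ih =>
    obtain ⟨i, hi⟩ : ∃ i, l i < m i := by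
      by_contra! h
      have : m = l := le_antisymm h hlm
      rw [this] at ht
      omega
    have h1 : Finsupp.single i 1 ≤ m := Finsupp.single_le_iff.2 (by omega)
    have h2 : (m - Finsupp.single i 1).degree + 1 = m.degree := by
      conv_rhs => rw [← tsub_add_cancel_of_le h1, map_add, Finsupp.degree_single]
    obtain ⟨m', h3, h4, h5⟩ := ih (m := m - Finsupp.single i 1) (fun j => by
      rw [Finsupp.tsub_apply, Finsupp.single_apply]
      have := hlm j
      split_ifs with hij
      · subst hij; omega
      · simpa using this) (by omega) (by omega)
    exact ⟨m', h3, h4.trans tsub_le_self, h5⟩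

theorem card_normalMons_mono (hs : s < n) {e e' : ℕ} (h : e ≤ e') :
    (normalMons hs.le d s e).card ≤ (normalMons hs.le d s e').card := by
  refine Finset.card_le_card_of_injOn
    (fun m => m + Finsupp.single ⟨n - 1, by omega⟩ (e' - e)) (fun m hm => ?_)
    fun _ _ _ _ h => add_right_cancel h
  obtain ⟨h1, h2⟩ := mem_normalMons.1 hm
  refine Finset.mem_coe.2 (mem_normalMons.2 ⟨?_, fun j hj => ?_⟩)
  · simp only [map_add, Finsupp.degree_single, h1]
    omega
  · have : Fin.castLE hs.le j ≠ ⟨n - 1, by omega⟩ := fun h => by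
      have := congrArg Fin.val h
      simp at this
      omega
    simp only [Finsupp.add_apply, Finsupp.single_eq_of_ne this, add_zero]
    exact h2 j hj

/-- The criterion `isGenericLocus_and_isLexsegment` with the lex-smallest monomials up to degree
`e₀`, when in degree `e₀` these are the monomials in `tailMons`. -/
theorem isGenericLocus_and_isLexsegment_of_spans (hn : 2 ≤ n) (hs : s ≤ n) {e₀ D : ℕ}
    (he₀ : 0 < e₀)
    (hD : (monsList n (List.ofFn d) e₀).length = D) (hDe : D ≤ e₀) (hDs : D = 0 ∨ s < n)
    (htail : ∀ l ∈ lexFirst n (List.ofFn d) e₀, ∀ i < n,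
      (i + 2 < n → l.getD i 0 = 0) ∧ (i + 2 = n → l.getD i 0 < D))
    (h : ∀ e ≤ e₀, ∃ a : Params k n d,
      Spans (idealOf a) e (monomials k (lexFirstMons n (List.ofFn d) e))) :
    IsGenericLocus (k := k) (MonomialOrder.lex (σ := Fin n)) d
        (vLocus k (MonomialOrder.lex (σ := Fin n)) d) ∧
      ∀ a ∈ vLocus k (MonomialOrder.lex (σ := Fin n)) d,
        IsLexsegment (initialIdeal (MonomialOrder.lex (σ := Fin n)) (idealOf a)) := by
  classical
  let B : ℕ → Finset (Fin n →₀ ℕ) := fun e =>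
    if e ≤ e₀ then lexFirstMons n (List.ofFn d) e else tailMons n D e
  have hB : ∀ e ≤ e₀, B e = lexFirstMons n (List.ofFn d) e := fun e he => if_pos he
  have hB' : ∀ e, e₀ < e → B e = tailMons n D e := fun e he => if_neg he.not_ge
  refine isGenericLocus_and_isLexsegment hs e₀ B (fun e m hm => ?_) (fun e m hm m' hm' hle => ?_)
    (fun e => ?_) (fun e he => ?_) fun e he m hm hmB => ?_
  · rcases le_or_gt e e₀ with he | he
    · rw [hB e he, mem_lexFirstMons] at hm
      obtain ⟨l, hl, rfl⟩ := hm
      obtain ⟨h1, h2⟩ := mem_monsList_of_mem_lexFirst hl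
      rw [degree_expo h1, h2]
    · rw [hB' e he, mem_tailMons] at hm
      exact hm.1
  · rcases le_or_gt e e₀ with he | he
    · rw [hB e he, mem_lexFirstMons] at hm ⊢
      obtain ⟨l, hl, rfl⟩ := hm
      exact ⟨_, mem_lexFirst_of_le hl hm' hle, expo_ofFn m'⟩
    · rw [hB' e he] at hm ⊢
      exact mem_tailMons_of_le hm hm' hle
  · rcases le_or_gt e e₀ with he | he
    · rw [hB e he, card_normalMons, ← length_lexFirst]
      exact (List.toFinset_card_le _).trans_eq (List.length_map _)
    · rw [hB' e he]
      refine (card_tailMons_le hn D e).trans ?_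
      rcases hDs with hD0 | hsn
      · omega
      · rw [← hD, ← card_normalMons hs]
        exact card_normalMons_mono hsn he.le
  · rw [hB e he]
    exact h e he
  -- That `m` is not in `tailMons` is seen on some `l ≤ m` of degree at most `e₀`; it is enlarged
  -- to degree `e₀`.
  · obtain ⟨i, l, hlm, hle, hli⟩ : ∃ (i : Fin n) (l : Fin n →₀ ℕ), l ≤ m ∧ l.degree ≤ e₀ ∧
        ((i : ℕ) + 2 < n ∧ l i ≠ 0 ∨ (i : ℕ) + 2 = n ∧ D ≤ l i) := by
      rw [hB' e he, mem_tailMons] at hmB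
      push Not at hmB
      obtain ⟨i, hi⟩ := hmB hm
      by_cases h1 : (i : ℕ) + 2 < n ∧ m i ≠ 0
      · exact ⟨i, Finsupp.single i 1, Finsupp.single_le_iff.2 (by omega),
          by rw [Finsupp.degree_single]; exact he₀, Or.inl ⟨h1.1, by simp⟩⟩
      · obtain ⟨h2, h3⟩ := hi (by tauto)
        exact ⟨i, Finsupp.single i D, Finsupp.single_le_iff.2 h3,
          by rw [Finsupp.degree_single]; exact hDe, Or.inr ⟨h2, by simp⟩⟩
    obtain ⟨m', h1, h2, h3⟩ := exists_degree_eq_of_le hlm hle (by omega : e₀ ≤ m.degree)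
    refine ⟨m', h2, h3, fun hm' => ?_⟩
    rw [hB e₀ le_rfl, mem_lexFirstMons] at hm'
    obtain ⟨t, ht, rfl⟩ := hm'
    have h4 := htail t ht i i.2
    have h5 := h1 i
    rw [expo_apply] at h5
    rcases hli with ⟨h6, h7⟩ | ⟨h6, h7⟩
    · have := h4.1 h6
      omega
    · have := h4.2 h6
      omega

/-- The lex-smallest monomials of degree `e₀` are those in `tailMons`, with `D` at most `e₀`. -/
def tailCheck (n : ℕ) (d : List ℕ) (e₀ : ℕ) : Bool :=
  decide ((monsList n d e₀).length ≤ e₀ ∧ ∀ l ∈ lexFirst n d e₀, ∀ i < n,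
    (i + 2 < n → l.getD i 0 = 0) ∧ (i + 2 = n → l.getD i 0 < (monsList n d e₀).length))

/-- The computation for complete intersections of dimension one, in all degrees up to the product
of the degrees of the forms. -/
def gridCheck (p n : ℕ) (A : List (List ℕ)) (d : List ℕ) : Bool :=
  tailCheck n d d.prod && (List.range (d.prod + 1)).all fun e =>
    regularMod p (monsList n d e).length
      (entryRows p (gridEntry d.length A) (monsList n d e) (lexFirst n d e))

/-- The computation for Artinian complete intersections of three ternary forms, in all degrees up to
the sum of the degrees of the forms, where the quotient vanishes. The monomials are listed in
decreasing order, since elimination without interchanges of rows meets a zero pivot otherwise. -/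
def powerCheck (p : ℕ) (A : List (List ℕ)) (d : List ℕ) : Bool :=
  (monsList 3 d d.sum).isEmpty && (List.range (d.sum + 1)).all fun e =>
    regularMod p (monsList 3 d e).reverse.length
      (entryRows p (powerEntry A) (monsList 3 d e).reverse (lexFirst 3 d e).reverse)

variable {p : ℕ} [Fact p.Prime] {A : List (List ℕ)}

theorem isGenericLocus_and_isLexsegment_of_gridCheck (hn : 2 ≤ n) (hs : s + 1 = n)
    (hd : ∀ i, 0 < d i) (hA : A.length = n) {A' : Matrix (Fin n) (Fin n) ℤ}
    (hAA' : rowsMatrix ℤ n A * A' = 1) (h : gridCheck p n A (List.ofFn d) = true) :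
    IsGenericLocus (k := k) (MonomialOrder.lex (σ := Fin n)) d
        (vLocus k (MonomialOrder.lex (σ := Fin n)) d) ∧
      ∀ a ∈ vLocus k (MonomialOrder.lex (σ := Fin n)) d,
        IsLexsegment (initialIdeal (MonomialOrder.lex (σ := Fin n)) (idealOf a)) := by
  rw [gridCheck, Bool.and_eq_true, List.all_eq_true, tailCheck, decide_eq_true_eq,
    List.length_ofFn] at h
  obtain ⟨⟨h1, h2⟩, h3⟩ := h
  refine isGenericLocus_and_isLexsegment_of_spans hn (by omega) ?_ rfl h1 (Or.inr (by omega)) h2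
    fun e he => exists_spans_of_grid hs hA hAA' (h3 e (List.mem_range.2 (by omega)))
  rw [List.prod_ofFn]
  exact Finset.prod_pos fun i _ => hd i

theorem isGenericLocus_and_isLexsegment_of_powerCheck {d : Fin 3 → ℕ} (hd : ∀ i, 0 < d i)
    {A' : Matrix (Fin 3) (Fin 3) ℤ} (hAA' : rowsMatrix ℤ 3 A * A' = 1)
    (h : powerCheck p A (List.ofFn d) = true) :
    IsGenericLocus (k := k) (MonomialOrder.lex (σ := Fin 3)) d
        (vLocus k (MonomialOrder.lex (σ := Fin 3)) d) ∧
      ∀ a ∈ vLocus k (MonomialOrder.lex (σ := Fin 3)) d,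
        IsLexsegment (initialIdeal (MonomialOrder.lex (σ := Fin 3)) (idealOf a)) := by
  rw [powerCheck, Bool.and_eq_true, List.all_eq_true, List.isEmpty_iff] at h
  obtain ⟨h1, h2⟩ := h
  have h0 : (List.ofFn d).sum = d 0 + d 1 + d 2 := by
    rw [List.sum_ofFn, Fin.sum_univ_three]
  have h3 := hd 0
  refine isGenericLocus_and_isLexsegment_of_spans (D := 0) (by omega) le_rfl
    (e₀ := (List.ofFn d).sum) (by omega) (by rw [h1]; rfl) (by omega) (Or.inl rfl) ?_
    fun e he => exists_spans_of_powers hAA' (h2 e (List.mem_range.2 (by omega)))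
  intro l hl
  rw [lexFirst, h1] at hl
  simp at hl

end Tail

/-! ### The computations -/

section Computation

/-! The coordinates are products of random triangular matrices with small entries, so that they are
invertible over the integers. -/

instance fact_prime_10007 : Fact (Nat.Prime 10007) := ⟨by norm_num⟩

/-- Coordinates for two ternary forms. -/
def coordinates₃₂ : List (List ℕ) := [[1, 2, 0], [1, 3, 2], [1, 4, 5]]

/-- Coordinates for three ternary forms. -/
def coordinates₃₃ : List (List ℕ) := [[1, 1, 2], [1, 2, 4], [2, 3, 7]]

/-- Coordinates for three quaternary forms. -/
def coordinates₄₃ : List (List ℕ) := [[1, 1, 3, 0], [2, 3, 6, 0], [2, 5, 7, 0], [2, 2, 7, 1]]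

theorem coordinates₃₂_mul :
    rowsMatrix ℤ 3 coordinates₃₂ * !![7, -10, 4; -3, 5, -2; 1, -2, 1] = 1 := by
  decide +kernel

theorem coordinates₃₃_mul :
    rowsMatrix ℤ 3 coordinates₃₃ * !![2, -1, 0; 1, 3, -2; -1, -1, 1] = 1 := by
  decide +kernel

theorem coordinates₄₃_mul : rowsMatrix ℤ 4 coordinates₄₃ *
    !![-9, 8, -3, 0; -2, 1, 0, 0; 4, -3, 1, 0; -6, 3, -1, 1] = 1 := by
  decide +kernel

theorem gridCheck₃₂ :
    ∀ x ∈ [2, 3], ∀ y ∈ [2, 3], gridCheck 10007 3 coordinates₃₂ [x, y] = true := by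
  decide +kernel

theorem powerCheck₃₃ : ∀ x ∈ [2, 3], ∀ y ∈ [2, 3], ∀ z ∈ [2, 3],
    powerCheck 10007 coordinates₃₃ [x, y, z] = true := by
  decide +kernel

theorem gridCheck₄₃ : ∀ x ∈ [2, 3], ∀ y ∈ [2, 3], ∀ z ∈ [2, 3],
    gridCheck 10007 4 coordinates₄₃ [x, y, z] = true := by
  decide +kernel

end Computation

end GenericIdeal

end

theorem corollary3p5 {k : Type*} [Field k] [CharZero k] (n s : ℕ) (d : Fin s → ℕ)
    (hns : (n = 3 ∧ s = 2) ∨ (n = 3 ∧ s = 3) ∨ (n = 4 ∧ s = 3))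
    (hd : ∀ i, 2 ≤ d i ∧ d i ≤ 3) :
    GenericIdeal.IsGenericLocus (k := k) (MonomialOrder.lex (σ := Fin n)) d
        (GenericIdeal.vLocus k (MonomialOrder.lex (σ := Fin n)) d) ∧
      ∀ a ∈ GenericIdeal.vLocus k (MonomialOrder.lex (σ := Fin n)) d,
        GenericIdeal.IsLexsegment
          (GenericIdeal.initialIdeal (MonomialOrder.lex (σ := Fin n))
            (GenericIdeal.idealOf a)) := by
  have hpos : ∀ i, 0 < d i := fun i => two_pos.trans_le (hd i).1
  have hmem : ∀ i, d i ∈ [2, 3] := fun i => by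
    obtain ⟨h1, h2⟩ := hd i
    interval_cases d i <;> simp
  rcases hns with ⟨rfl, rfl⟩ | ⟨rfl, rfl⟩ | ⟨rfl, rfl⟩
  · exact GenericIdeal.isGenericLocus_and_isLexsegment_of_gridCheck (by decide) rfl hpos rfl
      GenericIdeal.coordinates₃₂_mul (GenericIdeal.gridCheck₃₂ _ (hmem 0) _ (hmem 1))
  · exact GenericIdeal.isGenericLocus_and_isLexsegment_of_powerCheck hpos
      GenericIdeal.coordinates₃₃_mul (GenericIdeal.powerCheck₃₃ _ (hmem 0) _ (hmem 1) _ (hmem 2))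
  · exact GenericIdeal.isGenericLocus_and_isLexsegment_of_gridCheck (by decide) rfl hpos rfl
      GenericIdeal.coordinates₄₃_mul (GenericIdeal.gridCheck₄₃ _ (hmem 0) _ (hmem 1) _ (hmem 2))
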